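/- **Setting.** Let $R$ be a marked elliptic root system of type $X_l^{(1,1)}$ ($X_l=A_l,B_l,\dots,G_2$, $l\ge 1$) in an $(l+2)$-dimensional real vector space $F$ with positive semi-definite form $I$ whose radical is $2$-dimensional. Thus $Q(R)\cap\mathrm{rad}\,I=\mathbb Z a\oplus\mathbb Z\delta$ (where $Q(R)$ is the lattice generated by $R$ and $\mathbb R a$ is the marking), $\alpha_1,\dots,\alpha_l\in R$ are simple roots, $F_{\rm cl}=\bigoplus_i\mathbb R\alpha_i$, and $R=(R\cap F_{\rm cl})+\mathbb Z\delta+\mathbb Z a$ with $R\cap F_{\rm cl}$ a reduced irreducible finite root system whose highest root $\theta$ satisfies $I(\theta,\theta)=2$. Let $\tilde F=F\oplus\mathbb R\Lambda_0$ be the hyperbolic extension, with form $\tilde I$ extending $I$, $\mathrm{rad}\,\tilde I=\mathbb R a$, $\tilde I(\Lambda_0,\alpha_i)=0$ $(1\le i\le l)$, $\tilde I(\Lambda_0,\delta-\theta)=1$, $\tilde I(\Lambda_0,\Lambda_0)=0$. The elliptic Weyl group $W$ is generated by the reflections of $\tilde F$ in the elements of $R$. It acts on $Y=\{x\in\mathrm{Hom}_{\mathbb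 R}(\tilde F,\mathbb C): x(a)=-2\pi i,\ \mathrm{Re}\,x(\delta)>0\}$ by $(gx)(v)=x(g^{-1}v)$, hence on $Y_{\mathbb H}=\mathbb H\times\mathfrak h_{\mathbb C}\times\mathbb C$ (with $\mathfrak h_{\mathbb C}=\mathrm{Hom}_{\mathbb R}(F_{\rm cl},\mathbb C)$) through the isomorphism $Y\simeq Y_{\mathbb H}$, $x\mapsto(\tau,z,t)=\left(\frac{x(\delta)}{-2\pi i},\frac{x|_{F_{\rm cl}}}{2\pi i},\frac{x(\Lambda_0)}{2\pi i}\right)$, and it acts on $\mathbb C^*\times Y_{\mathbb H}$ trivially on the first factor. $Mp_2(\mathbb Z)$ is the group of pairs $(A,j)$ with $A=\begin{pmatrix}a&b\\c&d\end{pmatrix}\in SL_2(\mathbb Z)$ and $j$ holomorphic on $\mathbb H$ with $j(\tau)^2=c\tau+d$. It acts by $(A,j)\cdot(\omega,\tau)=(j(\tau)\omega,A\tau)$ on $\mathbb C^*\times\mathbb H$ and by $$(A,j)\cdot(\omega,\tau,z,t)=\Big(j(\tau)\omega,\ A\tau,\ \tfrac{z}{c\tau+d},\ t-\tfrac{c\langle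 z,z\rangle}{2(c\tau+d)}\Big)$$ on $\mathbb C^*\times Y_{\mathbb H}$, where $\langle\,,\rangle$ is the $\mathbb C$-bilinear form on $\mathfrak h_{\mathbb C}$ dual to $I|_{F_{\rm cl}}$. Let $U$ be the open unit disc, $Y_U=U\times\mathfrak h_{\mathbb C}\times\mathbb C$, $q=e^{2\pi i\tau}$, $q^\gamma=e^{2\pi i\gamma\tau}$, and let $\varphi_1$ be the map $\tau\mapsto q$, extended by the identity on the other coordinates. For $X=\mathbb H,U$, $k\in\frac12\mathbb Z$, $m\in\mathbb Z$, let $F_k(\mathbb C^*\times X)$ be the space of holomorphic functions on $\mathbb C^*\times X$ with $\omega\,\partial_\omega F=-2kF$, and let $F_{k,m}(\mathbb C^*\times Y_X)$ be the space of holomorphic functions on $\mathbb C^*\times Y_X$ with $\omega\,\partial_\omega f=-2kf$ and $\frac1{2\pi i}\partial_t f=mf$. Let $F^W_{k,m}(\mathbb C^*\times Y_{\mathbb H})$ be the subspace of $W$-invariant functions and $F^W_{k,m}(\mathbb C^*\times Y_U)$ the space of $f\in F_{k,m}(\mathbb C^*\times Y_U)$ with $\varphi_1^*f\in F^W_{k,m}(\mathbb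 C^*\times Y_{\mathbb H})$. A Jacobi form of weight $k$ and index $m$ is an $f\in F_{k,m}^W(\mathbb C^*\times Y_U)$ for which $\varphi_1^*f$ is $Mp_2(\mathbb Z)$-invariant; it is identified with the function $\varphi_1^*f$ on $\mathbb C^*\times Y_{\mathbb H}$. Let $\eta=q^{1/24}\prod_{n\ge1}(1-q^n)$, $E_2=1-24\sum_{n\ge1}\sigma_1(n)q^n$, and $$\delta_q=\omega^{-4}\Big[\tfrac1{24}E_2\,\omega\,\partial_\omega+\tfrac1{2\pi i}\partial_\tau\Big]\quad\text{on }\mathbb C^*\times\mathbb H.$$ **Statement.** Let $n\ge1$, $k\in\frac12\mathbb Z$, $m\in\mathbb Z$, and let $f_1,\dots,f_n\in F^W_{k,m}(\mathbb C^*\times Y_{\mathbb H})$, $\overline{f_1},\dots,\overline{f_n}\in F^W_{k,m}(\mathbb C^*\times Y_U)$, $F_1,\dots,F_n\in F_k(\mathbb C^*\times\mathbb H)$, $\overline{F_1},\dots,\overline{F_n}\in F_k(\mathbb C^*\times U)$, $\gamma_1,\dots,\gamma_n\in\mathbb Q$ and a map $\rho:Mp_2(\mathbb Z)\to GL_n(\mathbb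 C)$ satisfy 1. $f_j(\omega,\tau,z,t)=q^{\gamma_j}\,\overline{f_j}(\omega,q,z,t)$ for all $j$; 2. $F_j(\omega,\tau)=q^{\gamma_j}\,\overline{F_j}(\omega,q)$ for all $j$; 3. $(f_1,\dots,f_n)(g\cdot(\omega,\tau,z,t))=(f_1,\dots,f_n)(\omega,\tau,z,t)\,\rho(g)$ for all $g\in Mp_2(\mathbb Z)$; 4. $(F_1,\dots,F_n)(g\cdot(\omega,\tau))=(F_1,\dots,F_n)(\omega,\tau)\,\rho(g)$ for all $g\in Mp_2(\mathbb Z)$. Let $\beta_2,\dots,\beta_n$ be non-negative integers, $\gamma=\gamma_1+\cdots+\gamma_n$, $\beta=kn+2(\beta_2+\cdots+\beta_n)$, and let $\Delta$ be the $n\times n$ matrix with first row $(f_1,\dots,f_n)$ and $i$-th row $(\delta_q^{\beta_i}F_1,\dots,\delta_q^{\beta_i}F_n)$ for $2\le i\le n$. Then: (a) if the pairs $(f_1,F_1),\dots,(f_n,F_n)$ are linearly independent over $\mathbb C$ (in particular, if $\det\Delta$ is not identically zero), then $24\gamma\in\mathbb Z$; (b) whenever $24\gamma\in\mathbb Z$,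 the function $(\eta/\omega)^{-24\gamma}\det\Delta$ is a Jacobi form of weight $\beta-12\gamma$ and index $m$. -/

import Mathlib

noncomputable section

namespace EllipticJacobi

open Complex
open UpperHalfPlane hiding I
open scoped MatrixGroups

/-! ### Elliptic root systems -/

section RootSystem

variable {V : Type*} [AddCommGroup V] [Module ℝ V]

/-- The radical of the restriction of the bilinear form `B` to the subspace `F`. -/
def formRadical (B : LinearMap.BilinForm ℝ V) (F : Submodule ℝ V) : Submodule ℝ V :=
  F ⊓ B.orthogonal F

/-- `α^∨ = 2 α / B(α, α)`. -/
def coroot (B : LinearMap.BilinForm ℝ V) (α : V) : V := (2 / B α α) • α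

/-- `w_α(u) = u - B(u, α^∨) α`. -/
def refl (B : LinearMap.BilinForm ℝ V) (α u : V) : V := u - B u (coroot B α) • α

/-- `R` is an elliptic root system belonging to `(F, I)`, where `F` is a subspace of the ambient
space `V`, of dimension `l + 2`, and `I` is the restriction of `B` to `F`: a positive semi-definite
symmetric form whose radical has dimension two. -/
structure IsEllipticRootSystem (l : ℕ) (B : LinearMap.BilinForm ℝ V) (F : Submodule ℝ V)
    (R : Set V) : Prop where
  pos : 0 < l
  finrank_eq : Module.finrank ℝ F = l + 2
  symm : ∀ x ∈ F, ∀ y ∈ F, B x y = B y x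
  nonneg : ∀ x ∈ F, 0 ≤ B x x
  finrank_radical : Module.finrank ℝ (formRadical B F) = 2
  subset : ∀ α ∈ R, α ∈ F
  nonisotropic : ∀ α ∈ R, B α α ≠ 0
  /-- The root lattice `Q(R)` is a full lattice of `F`. -/
  full_lattice : ∃ b : Module.Basis (Fin (l + 2)) ℝ F,
    AddSubgroup.closure R = AddSubgroup.closure (Set.range fun i => (b i : V))
  integral : ∀ α ∈ R, ∀ β ∈ R, ∃ n : ℤ, B α (coroot B β) = n
  reflection : ∀ α ∈ R, refl B α '' R = R
  irreducible : ∀ R₁ R₂ : Set V, R = R₁ ∪ R₂ → (∀ x ∈ R₁, ∀ y ∈ R₂, B x y = 0) →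
    R₁ = ∅ ∨ R₂ = ∅

/-- A marked elliptic root system of type `X_l^{(1,1)}` (`X_l = A_l, B_l, …, G_2`), together with
its hyperbolic extension `V = F̃` and the usual choices: generators `a`, `δ` of the radical of the
root lattice (the marking being `ℝ a`), simple roots `α_1, …, α_l`, and `Λ₀`. -/
structure EllipticRootData (l : ℕ) (V : Type*) [AddCommGroup V] [Module ℝ V] where
  /-- the form `Ĩ` on `F̃` -/
  form : LinearMap.BilinForm ℝ V
  /-- the subspace `F` of `F̃` -/
  F : Submodule ℝ V
  /-- the roots -/
  R : Set V
  isElliptic : IsEllipticRootSystem l form F R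
  a : V
  δ : V
  linearIndependent_rad : LinearIndependent ℝ ![a, δ]
  /-- `Q(R) ∩ rad I = ℤ a ⊕ ℤ δ`. -/
  lattice_rad : ∀ x : V, (x ∈ AddSubgroup.closure R ∧ x ∈ formRadical form F) ↔
    ∃ m n : ℤ, x = m • a + n • δ
  /-- simple roots -/
  α : Fin l → V
  α_mem : ∀ i, α i ∈ R
  /-- The classes of the `α i` are linearly independent in `F̃ / rad I` … -/
  α_indep : LinearIndependent ℝ fun i => (formRadical form F).mkQ (α i)
  /-- … and every root is, modulo `rad I`, a combination of them with natural number coefficients,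
  up to sign. -/
  α_simple : ∀ β ∈ R, ∃ c : Fin l → ℕ,
    β - ∑ i, c i • α i ∈ formRadical form F ∨ β + ∑ i, c i • α i ∈ formRadical form F
  /-- Type `(1,1)`: `R = R_cl + ℤ δ + ℤ a` with `R_cl = R ∩ F_cl`, `F_cl = ⨁ ℝ α_i`. -/
  type_one_one : R = {x | ∃ β ∈ R, β ∈ Submodule.span ℝ (Set.range α) ∧
    ∃ m n : ℤ, x = β + m • δ + n • a}
  /-- The finite root system is reduced. -/
  reduced : ∀ β ∈ R, (2 : ℝ) • β ∉ R
  /-- the highest root, in `F_cl ∩ R` -/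
  θ : V
  θ_mem : θ ∈ R
  θ_mem_span : θ ∈ Submodule.span ℝ (Set.range α)
  θ_highest : ∀ β ∈ R, ∃ c : Fin l → ℕ, θ - β - ∑ i, c i • α i ∈ formRadical form F
  /-- normalization of the form -/
  θ_norm : form θ θ = 2
  /-- `F̃` is a hyperbolic extension of `F`. -/
  finrank_eq : Module.finrank ℝ V = l + 3
  symm : ∀ x y, form x y = form y x
  ker_form : LinearMap.ker form = Submodule.span ℝ {a}
  /-- the zeroth fundamental weight; `α_0 = δ - θ` -/
  Λ₀ : V
  Λ₀_coroot : ∀ i, form Λ₀ (coroot form (α i)) = 0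
  Λ₀_coroot_zero : form Λ₀ (coroot form (δ - θ)) = 1
  Λ₀_norm : form Λ₀ Λ₀ = 0

end RootSystem

/-! ### The domains, and the coordinates `(ω, τ, z, t)` and `(ω, q, z, t)` -/

/-- Ambient space of `ℂ^* × Y_ℍ` (coordinates `(ω, τ, z, t)`) and of `ℂ^* × Y_U` (coordinates
`(ω, q, z, t)`). A point `z` of `𝔥_ℂ = Hom_ℝ(F_cl, ℂ)` is given by its values `z_i = z(α_i)` on
the basis of simple roots. -/
abbrev Pt (l : ℕ) : Type := ℂ × ℂ × (Fin l → ℂ) × ℂ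

/-- `ℂ^* × Y_ℍ`. -/
def domYH (l : ℕ) : Set (Pt l) := {p | p.1 ≠ 0 ∧ 0 < p.2.1.im}

/-- `ℂ^* × Y_U`, with `U` the open unit disc. -/
def domYU (l : ℕ) : Set (Pt l) := {p | p.1 ≠ 0 ∧ ‖p.2.1‖ < 1}

/-- `ℂ^* × ℍ`. -/
def domH : Set (ℂ × ℂ) := {p | p.1 ≠ 0 ∧ 0 < p.2.im}

/-- `ℂ^* × U`. -/
def domU : Set (ℂ × ℂ) := {p | p.1 ≠ 0 ∧ ‖p.2‖ < 1}

/-- `q^γ = exp(2πiγτ)`. -/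
def qpow (γ : ℚ) (τ : ℂ) : ℂ := cexp (2 * Real.pi * I * γ * τ)

/-- `φ₁ : ℂ^* × Y_ℍ → ℂ^* × Y_U`, `(ω, τ, z, t) ↦ (ω, e^{2πiτ}, z, t)`. -/
def phiY {l : ℕ} (p : Pt l) : Pt l := (p.1, cexp (2 * Real.pi * I * p.2.1), p.2.2)

/-- `φ₁ : ℂ^* × ℍ → ℂ^* × U`, `(ω, τ) ↦ (ω, e^{2πiτ})`. -/
def phi (p : ℂ × ℂ) : ℂ × ℂ := (p.1, cexp (2 * Real.pi * I * p.2))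

/-! ### Vector fields and function spaces -/

/-- `E_ω = ω ∂/∂ω`, on functions of `(ω, …)`. -/
def Eω {X : Type*} (f : ℂ × X → ℂ) (p : ℂ × X) : ℂ := p.1 * deriv (fun w => f (w, p.2)) p.1

/-- `E = ∂/∂Λ₀`; since `t = Λ₀ / (2πi)`, this is `(2πi)⁻¹ ∂/∂t`. -/
def EΛ {l : ℕ} (f : Pt l → ℂ) (p : Pt l) : ℂ :=
  (2 * Real.pi * I)⁻¹ * deriv (fun s => f (p.1, p.2.1, p.2.2.1, s)) p.2.2.2

/-- `δ_q = ω⁻⁴ [ (1/24) E₂ ω ∂/∂ω + (2πi)⁻¹ ∂/∂τ ]` on functions on `ℂ^* × ℍ`. -/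
def deltaQ (F : ℂ × ℂ → ℂ) (p : ℂ × ℂ) : ℂ :=
  (p.1 ^ 4)⁻¹ * (1 / 24 * EisensteinSeries.E2 (ofComplex p.2) * Eω F p +
    (2 * Real.pi * I)⁻¹ * deriv (fun s => F (p.1, s)) p.2)

/-- `F_k(D)`, for `D = ℂ^* × ℍ` or `ℂ^* × U`. -/
def MemF (k : ℚ) (D : Set (ℂ × ℂ)) (F : ℂ × ℂ → ℂ) : Prop :=
  DifferentiableOn ℂ F D ∧ ∀ p ∈ D, Eω F p = (-2 * k : ℚ) * F p

/-- `F_{k,m}(D)`, for `D = ℂ^* × Y_ℍ` or `ℂ^* × Y_U`. -/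
def MemFY {l : ℕ} (k : ℚ) (m : ℤ) (D : Set (Pt l)) (f : Pt l → ℂ) : Prop :=
  DifferentiableOn ℂ f D ∧
    ∀ p ∈ D, Eω f p = (-2 * k : ℚ) * f p ∧ EΛ f p = m * f p

/-! ### The elliptic Weyl group and invariance under it -/

namespace EllipticRootData

variable {l : ℕ} {V : Type*} [AddCommGroup V] [Module ℝ V] (S : EllipticRootData l V)

/-- The elliptic Weyl group. -/
def W : Subgroup (V ≃ₗ[ℝ] V) :=
  Subgroup.closure {g | ∃ α ∈ S.R, ∀ u, g u = refl S.form α u}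

/-- The domain `Y` in `Hom_ℝ(F̃, ℂ)`. -/
def Y : Set (V →ₗ[ℝ] ℂ) := {x | x S.a = -2 * Real.pi * I ∧ 0 < (x S.δ).re}

/-- The isomorphism `Y ≃ Y_ℍ`, `x ↦ (τ, z, t) = (δ/a, -α/a, -Λ₀/a)`. -/
def coord (x : V →ₗ[ℝ] ℂ) : ℂ × (Fin l → ℂ) × ℂ :=
  (x S.δ / x S.a, fun i => -(x (S.α i) / x S.a), -(x S.Λ₀ / x S.a))

/-- Invariance of a function on `ℂ^* × Y_ℍ` under `W`, which acts trivially on `ℂ^*` and by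
`⟨g x, v⟩ = ⟨x, g⁻¹ v⟩` on `Y ≃ Y_ℍ`. -/
def IsWInvariant (f : Pt l → ℂ) : Prop :=
  ∀ g ∈ S.W, ∀ x ∈ S.Y, ∀ ω : ℂ, ω ≠ 0 →
    f (ω, S.coord (x ∘ₗ (g⁻¹ : V ≃ₗ[ℝ] V).toLinearMap)) = f (ω, S.coord x)

/-- `F_{k,m}^W(ℂ^* × Y_ℍ)`. -/
def MemFWH (k : ℚ) (m : ℤ) (f : Pt l → ℂ) : Prop :=
  MemFY k m (domYH l) f ∧ S.IsWInvariant f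

/-- `F_{k,m}^W(ℂ^* × Y_U)`. -/
def MemFWU (k : ℚ) (m : ℤ) (f : Pt l → ℂ) : Prop :=
  MemFY k m (domYU l) f ∧ S.MemFWH k m (f ∘ phiY)

/-- The Gram matrix of the simple roots. -/
def gram : Matrix (Fin l) (Fin l) ℝ := Matrix.of fun i j => S.form (S.α i) (S.α j)

/-- `⟨z, z⟩` for the `ℂ`-bilinear form on `𝔥_ℂ = Hom_ℝ(F_cl, ℂ)` dual to the form on `F_cl`; in the
coordinates `z_i = z(α_i)` its matrix is the inverse of the Gram matrix of the `α_i`. -/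
def dualSq (z : Fin l → ℂ) : ℂ := z ⬝ᵥ ((S.gram⁻¹).map (algebraMap ℝ ℂ)).mulVec z

end EllipticRootData

/-! ### The metaplectic group and its actions -/

/-- `Mp₂(ℤ)`: pairs `(A, j)`, `A ∈ SL₂(ℤ)`, `j` holomorphic on `ℍ` with `j(τ)² = cτ + d`. -/
structure Mp2Z where
  A : SL(2, ℤ)
  j : ℍ → ℂ
  holo : DifferentiableOn ℂ (j ∘ ofComplex) {τ : ℂ | 0 < τ.im}
  sq : ∀ τ : ℍ, j τ ^ 2 = (A 1 0 : ℂ) * τ + (A 1 1 : ℂ)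

/-- The action on `ℂ^* × ℍ`: `(A, j)·(ω, τ) = (j(τ) ω, Aτ)`. -/
def Mp2Z.act (g : Mp2Z) (ω : ℂ) (τ : ℍ) : ℂ × ℂ := (g.j τ * ω, ((g.A • τ : ℍ) : ℂ))

namespace EllipticRootData

variable {l : ℕ} {V : Type*} [AddCommGroup V] [Module ℝ V] (S : EllipticRootData l V)

/-- The action on `ℂ^* × Y_ℍ`:
`(A, j)·(ω, τ, z, t) = (j(τ) ω, Aτ, z / (cτ + d), t - c⟨z, z⟩ / (2(cτ + d)))`. -/
def mpAct (g : Mp2Z) (ω : ℂ) (τ : ℍ) (z : Fin l → ℂ) (t : ℂ) : Pt l :=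
  let d : ℂ := (g.A 1 0 : ℂ) * τ + (g.A 1 1 : ℂ)
  (g.j τ * ω, ((g.A • τ : ℍ) : ℂ), d⁻¹ • z, t - (g.A 1 0 : ℂ) * S.dualSq z / (2 * d))

/-- Invariance of a function on `ℂ^* × Y_ℍ` under `Mp₂(ℤ)`. -/
def IsMpInvariant (f : Pt l → ℂ) : Prop :=
  ∀ (g : Mp2Z) (ω : ℂ) (τ : ℍ) (z : Fin l → ℂ) (t : ℂ), ω ≠ 0 →
    f (S.mpAct g ω τ z t) = f (ω, τ, z, t)

/-- `J_{k,m}`: Jacobi forms of weight `k` and index `m`, as functions on `ℂ^* × Y_U`. -/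
def IsJacobiForm (k : ℚ) (m : ℤ) (f : Pt l → ℂ) : Prop :=
  S.MemFWU k m f ∧ S.IsMpInvariant (f ∘ phiY)

end EllipticRootData

/-- The matrix with first row `f_1, …, f_n` and further rows `δ_q^{β_i} F_1, …, δ_q^{β_i} F_n`,
evaluated at a point of `ℂ^* × Y_ℍ`; here `n = r + 1` and `β` lists `β_2, …, β_n`. -/
def detMatrix {l r : ℕ} (f : Fin (r + 1) → Pt l → ℂ) (F : Fin (r + 1) → ℂ × ℂ → ℂ)
    (β : Fin r → ℕ) (p : Pt l) : Matrix (Fin (r + 1)) (Fin (r + 1)) ℂ :=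
  Matrix.of (Fin.cons (fun j => f j p) fun i j => (deltaQ^[β i] (F j)) (p.1, p.2.1))

end EllipticJacobi

end

noncomputable section

namespace EllipticJacobi

open Complex hiding eta
open UpperHalfPlane hiding I
open scoped MatrixGroups
open ModularForm (eta)

/-! The operator `δ_q` annihilates `η/ω`, because the logarithmic derivative of `η` is a multiple of
`E₂`. A homogeneous `F` of weight `k` has the form `(η/ω)^{2k} u(τ)`, and `δ_q` sends it to
`(η/ω)^{2k+4} Du` with `D = (2πi η⁴)⁻¹ d/dτ` (`deltaQ_eta_zpow_mul`). Powers of `δ_q` thus reduce to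
powers of `D`, which keep the shape `q^e × (holomorphic in q)` up to a shift of `e` undone by `η⁴`
(`MemF.deltaQ_iterate_expansion`), and which commute with `τ ↦ -1/τ` up to a constant
(`deltaQ_iterate_neg_inv`).

For (b), all rows of `Δ` are therefore multiplied by the same matrix under the lift of `S`, and
`η^{-24γ}` removes the fractional powers of `q` from `det Δ`. What remains is a function of `q`,
hence `T`-invariant, and it acquires a scalar `s` under `S`. The relations `S⁸ = 1` and `S² = (ST)³`
in `Mp₂(ℤ)` force `s = 1` unless the function vanishes (`isMpInvariant_of_generators`). Invariance
under `W` survives because the cofactors depend only on `ω` and `τ`, which `W` fixes.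

For (a), linear independence makes `ρ` reverse products, so `det ρ` is a character. The same
relations give `det ρ(T)^24 = 1`, while `ρ(T)` is diagonal with entries `e^{2πiγ_j}`. -/

/-! ### The eta function and its product -/

/-- The product `∏ (1 - q ^ (n + 1))`. -/
def etaProd (q : ℂ) : ℂ := ∏' n : ℕ, (1 - q ^ (n + 1))

theorem differentiableOn_etaProd : DifferentiableOn ℂ etaProd (Metric.ball 0 1) :=
  ModularForm.differentiableOn_tprod_one_sub_pow

theorem etaProd_ne_zero {q : ℂ} (hq : ‖q‖ < 1) : etaProd q ≠ 0 := by
  have := tprod_one_add_ne_zero_of_summable (f := fun n : ℕ => -q ^ (n + 1)) (fun n h => ?_) ?_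
  · simpa [etaProd, sub_eq_add_neg] using this
  · have h1 : q ^ (n + 1) = 1 := by linear_combination -h
    have h2 : ‖q‖ ^ (n + 1) = 1 := by rw [← norm_pow, h1, norm_one]
    exact (pow_lt_one₀ (norm_nonneg q) hq (Nat.succ_ne_zero n)).ne h2
  · simpa using (summable_nat_add_iff 1).mpr (summable_geometric_of_lt_one (norm_nonneg _) hq)

/-- Isolates the only fractional power of `q` in `η`; the other factor is holomorphic and
nonvanishing on the whole disc, including `q = 0`. -/
theorem eta_eq (τ : ℂ) :
    eta τ = cexp (2 * Real.pi * I * (1 / 24) * τ) * etaProd (cexp (2 * Real.pi * I * τ)) := by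
  unfold ModularForm.eta etaProd
  congr 1
  · simp only [Function.Periodic.qParam]
    congr 1; push_cast; ring
  · simp only [ModularForm.eta_q_eq_pow]

theorem norm_exp_two_pi_I_mul_lt_one {τ : ℂ} (hτ : 0 < τ.im) :
    ‖cexp (2 * Real.pi * I * τ)‖ < 1 :=
  norm_exp_two_pi_I_lt_one ⟨τ, hτ⟩

theorem eta_ne_zero {τ : ℂ} (hτ : 0 < τ.im) : eta τ ≠ 0 := ModularForm.eta_ne_zero hτ

theorem differentiableAt_eta {τ : ℂ} (hτ : 0 < τ.im) : DifferentiableAt ℂ eta τ :=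
  ModularForm.differentiableAt_eta_of_mem_upperHalfPlaneSet hτ

theorem exp_two_pi_I_mul_add_one (τ : ℂ) :
    cexp (2 * Real.pi * I * (τ + 1)) = cexp (2 * Real.pi * I * τ) := by
  rw [mul_add, mul_one, Complex.exp_add, Complex.exp_two_pi_mul_I, mul_one]

theorem eta_add_one (τ : ℂ) : eta (τ + 1) = cexp (2 * Real.pi * I * (1 / 24)) * eta τ := by
  rw [eta_eq, eta_eq, exp_two_pi_I_mul_add_one, ← mul_assoc, ← Complex.exp_add]
  congr 2; ring

theorem im_neg_inv_pos {τ : ℂ} (hτ : 0 < τ.im) : 0 < ((-τ)⁻¹).im :=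
  UpperHalfPlane.im_inv_neg_coe_pos ⟨τ, hτ⟩

theorem eta_neg_inv {τ : ℂ} (hτ : 0 < τ.im) :
    eta (-τ)⁻¹ = (sqrt I)⁻¹ * (sqrt τ * eta τ) := by
  have := ModularForm.eta_comp_eq_csqrt_I_inv hτ
  simp only [Function.comp, Pi.smul_apply, Pi.mul_apply, smul_eq_mul] at this
  rw [← this]; congr 1; rw [inv_neg, neg_div, one_div]

theorem sqrt_sq (z : ℂ) : sqrt z ^ 2 = z := by
  rw [sqrt, ← cpow_nat_mul]
  simp

theorem sqrt_ne_zero {z : ℂ} (hz : z ≠ 0) : sqrt z ≠ 0 := fun h => hz (by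
  rw [← sqrt_sq z, h]; simp)

theorem ne_zero_of_im_pos {τ : ℂ} (hτ : 0 < τ.im) : τ ≠ 0 := by
  rintro rfl; simp at hτ

/-! ### The operator `δ_q` on homogeneous functions -/

/-- The derivation `(2πi η⁴)⁻¹ d/dτ`, which is `δ_q` in weight zero. -/
def etaDeriv (u : ℂ → ℂ) (τ : ℂ) : ℂ := (2 * Real.pi * I)⁻¹ * deriv u τ / eta τ ^ 4

theorem isOpen_upper : IsOpen {τ : ℂ | 0 < τ.im} := isOpen_lt continuous_const continuous_im

theorem differentiableOn_etaDeriv {u : ℂ → ℂ} (hu : DifferentiableOn ℂ u {τ | 0 < τ.im}) :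
    DifferentiableOn ℂ (etaDeriv u) {τ | 0 < τ.im} := by
  refine DifferentiableOn.div ((hu.deriv isOpen_upper).const_mul _) ?_ ?_
  · exact DifferentiableOn.pow (fun τ hτ => (differentiableAt_eta hτ).differentiableWithinAt) 4
  · exact fun τ hτ => pow_ne_zero _ (eta_ne_zero hτ)

theorem differentiableOn_etaDeriv_iterate {u : ℂ → ℂ} (hu : DifferentiableOn ℂ u {τ | 0 < τ.im})
    (n : ℕ) : DifferentiableOn ℂ (etaDeriv^[n] u) {τ | 0 < τ.im} := by
  induction n with
  | zero => exact hu
  | succ n ih => rw [Function.iterate_succ_apply']; exact differentiableOn_etaDeriv ih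

/-- A function `F` with `z F' = n F` on the punctured plane is homogeneous of degree `n`. -/
theorem eq_zpow_mul_of_euler {g : ℂ → ℂ} {n : ℤ} (hg : DifferentiableOn ℂ g {0}ᶜ)
    (h : ∀ w ≠ 0, w * deriv g w = n * g w) {w : ℂ} (hw : w ≠ 0) : g w = w ^ n * g 1 := by
  have hopen : IsOpen ({0}ᶜ : Set ℂ) := isOpen_compl_singleton
  have hconn : IsPreconnected ({0}ᶜ : Set ℂ) :=
    (isConnected_compl_singleton_of_one_lt_rank (by simp) 0).isPreconnected
  -- The punctured plane is connected, so a vanishing derivative makes this quotient constant.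
  have hder : ∀ x ∈ ({0}ᶜ : Set ℂ), HasDerivAt (fun w => w ^ (-n) * g w) 0 x := by
    intro x hx
    have hx0 : x ≠ 0 := hx
    have h1 := (hasDerivAt_zpow (-n) x (Or.inl hx0)).mul
      (hg.differentiableAt (hopen.mem_nhds hx)).hasDerivAt
    refine h1.congr_deriv ?_
    have h2 : deriv g x = n * g x / x := by rw [← h x hx0]; field_simp
    rw [h2, zpow_sub_one₀ hx0]
    push_cast; field_simp; ring
  have := hopen.is_const_of_deriv_eq_zero hconn
    (fun x hx => (hder x hx).differentiableAt.differentiableWithinAt)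
    (fun x hx => (hder x hx).deriv) (x := w) (y := 1) hw (by simp)
  simp only [one_zpow, one_mul] at this
  rw [← this, ← mul_assoc, ← zpow_add₀ hw]; simp

theorem MemF.eq_zpow_mul {k : ℚ} {c : ℤ} (hk : 2 * k = c) {F : ℂ × ℂ → ℂ}
    (hF : MemF k domH F) {ω τ : ℂ} (hω : ω ≠ 0) (hτ : 0 < τ.im) :
    F (ω, τ) = ω ^ (-c) * F (1, τ) := by
  refine eq_zpow_mul_of_euler (g := fun w => F (w, τ)) ?_ ?_ hω
  · exact hF.1.comp (f := fun w : ℂ => (w, τ)) (by fun_prop) fun w hw => ⟨hw, hτ⟩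
  · intro w hw
    have := hF.2 (w, τ) ⟨hw, hτ⟩
    simp only [Eω] at this
    rw [this, neg_mul, hk]; push_cast; rfl

/-- Homogeneity gives formulas only on the domain; since the domain is open, the derivatives in
`deltaQ` see nothing else, and the operator can be iterated on such formulas. -/
theorem deltaQ_congr {F G : ℂ × ℂ → ℂ} (h : Set.EqOn F G domH) :
    Set.EqOn (deltaQ F) (deltaQ G) domH := by
  rintro ⟨ω, τ⟩ hp
  have h1 : (fun w => F (w, τ)) =ᶠ[nhds ω] fun w => G (w, τ) := by
    filter_upwards [isOpen_ne.mem_nhds hp.1] with w hw using h ⟨hw, hp.2⟩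
  have h2 : (fun s => F (ω, s)) =ᶠ[nhds τ] fun s => G (ω, s) := by
    filter_upwards [isOpen_upper.mem_nhds hp.2] with s hs using h ⟨hp.1, hs⟩
  simp only [deltaQ, Eω, h1.deriv_eq, h2.deriv_eq]

/-- On `(η/ω)^c` the Euler term contributes `-c E₂/24` and the `τ`-derivative `+c E₂/24`. They
cancel, and only the derivative of `u` survives. -/
theorem deltaQ_eta_zpow_mul {u : ℂ → ℂ} (hu : DifferentiableOn ℂ u {τ | 0 < τ.im}) (c : ℤ) :
    Set.EqOn (deltaQ fun p => (eta p.2 / p.1) ^ c * u p.2)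
      (fun p => (eta p.2 / p.1) ^ (c + 4) * etaDeriv u p.2) domH := by
  rintro ⟨ω, τ⟩ ⟨hω, hτ⟩
  simp only at hω hτ
  have hη := eta_ne_zero hτ
  have hlog : deriv eta τ = Real.pi * I / 12 * EisensteinSeries.E2 (ofComplex τ) * eta τ := by
    have := ModularForm.logDeriv_eta_eq_E2 ⟨τ, hτ⟩
    rw [ofComplex_apply_of_im_pos hτ, ← this, logDeriv_apply]
    field_simp
  have hE : deriv (fun w => (eta τ / w) ^ c * u τ) ω = -c * (eta τ / ω) ^ c / ω * u τ := by
    have h0 : HasDerivAt (fun w : ℂ => eta τ / w) (-eta τ / ω ^ 2) ω := by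
      refine ((hasDerivAt_const ω (eta τ)).fun_div (hasDerivAt_id' ω) hω).congr_deriv ?_
      simp
    have h1 := ((hasDerivAt_zpow c (eta τ / ω) (Or.inl (div_ne_zero hη hω))).comp ω h0).mul_const
      (u τ)
    refine h1.deriv.trans ?_
    rw [zpow_sub_one₀ (div_ne_zero hη hω)]
    field_simp
  have hD : deriv (fun s => (eta s / ω) ^ c * u s) τ =
      c * (eta τ / ω) ^ c * (deriv eta τ / eta τ) * u τ + (eta τ / ω) ^ c * deriv u τ := by
    have h0 : HasDerivAt (fun s : ℂ => eta s / ω) (deriv eta τ / ω) τ :=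
      (differentiableAt_eta hτ).hasDerivAt.div_const ω
    have h1 := ((hasDerivAt_zpow c (eta τ / ω) (Or.inl (div_ne_zero hη hω))).comp τ h0).mul
      (hu.differentiableAt (isOpen_upper.mem_nhds hτ)).hasDerivAt
    refine h1.deriv.trans ?_
    simp only [Function.comp]
    rw [zpow_sub_one₀ (div_ne_zero hη hω)]
    field_simp
  simp only [deltaQ, Eω, hE, hD, hlog, etaDeriv]
  rw [zpow_add₀ (div_ne_zero hη hω)]
  have hpi : (Real.pi : ℂ) ≠ 0 := by exact_mod_cast Real.pi_ne_zero
  generalize (eta τ / ω) ^ c = X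
  rw [show ((4 : ℤ)) = ((4 : ℕ) : ℤ) from rfl, zpow_natCast]
  field_simp
  ring

theorem deltaQ_iterate_eta_zpow_mul {u : ℂ → ℂ} (hu : DifferentiableOn ℂ u {τ | 0 < τ.im}) (c : ℤ)
    {F : ℂ × ℂ → ℂ} (hF : Set.EqOn F (fun p => (eta p.2 / p.1) ^ c * u p.2) domH) (n : ℕ) :
    Set.EqOn (deltaQ^[n] F)
      (fun p => (eta p.2 / p.1) ^ (c + 4 * n) * (etaDeriv^[n] u) p.2) domH := by
  induction n with
  | zero => simpa using hF
  | succ n ih =>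
    rw [Function.iterate_succ_apply', Function.iterate_succ_apply']
    refine (deltaQ_congr ih).trans ?_
    convert deltaQ_eta_zpow_mul (differentiableOn_etaDeriv_iterate hu n) (c + 4 * n) using 4
    push_cast; ring

/-- The weight zero function attached to `F`. -/
def weightZero (c : ℤ) (F : ℂ × ℂ → ℂ) (τ : ℂ) : ℂ := F (1, τ) / eta τ ^ c

theorem differentiableOn_weightZero {k : ℚ} (c : ℤ) {F : ℂ × ℂ → ℂ} (hF : MemF k domH F) :
    DifferentiableOn ℂ (weightZero c F) {τ | 0 < τ.im} := by
  refine DifferentiableOn.div ?_ ?_ fun τ hτ => zpow_ne_zero _ (eta_ne_zero hτ)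
  · exact hF.1.comp (f := fun τ : ℂ => ((1 : ℂ), τ)) (by fun_prop) fun τ hτ => ⟨one_ne_zero, hτ⟩
  · exact fun τ hτ => ((differentiableAt_eta hτ).zpow
      (Or.inl (eta_ne_zero hτ))).differentiableWithinAt

theorem MemF.deltaQ_iterate {k : ℚ} {c : ℤ} (hk : 2 * k = c) {F : ℂ × ℂ → ℂ}
    (hF : MemF k domH F) (n : ℕ) :
    Set.EqOn (deltaQ^[n] F)
      (fun p => (eta p.2 / p.1) ^ (c + 4 * n) * (etaDeriv^[n] (weightZero c F)) p.2) domH := by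
  refine deltaQ_iterate_eta_zpow_mul (differentiableOn_weightZero c hF) c ?_ n
  rintro ⟨ω, τ⟩ ⟨hω, hτ⟩
  simp only at hω hτ
  simp only [hF.eq_zpow_mul hk hω hτ, weightZero, div_zpow, zpow_neg]
  have := zpow_ne_zero c (eta_ne_zero hτ)
  field_simp

/-! ### Expansions in `q` -/

/-- In the variable `q`, `(2πi)⁻¹ d/dτ` is `q d/dq`, which preserves the exponent `e`. Division by
`η⁴` lowers it by `4/24`. -/
theorem etaDeriv_exp_mul {u ψ : ℂ → ℂ} (e : ℂ) (hψ : DifferentiableOn ℂ ψ (Metric.ball 0 1))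
    (h : ∀ τ : ℂ, 0 < τ.im →
      u τ = cexp (2 * Real.pi * I * e * τ) * ψ (cexp (2 * Real.pi * I * τ))) :
    ∃ ψ' : ℂ → ℂ, DifferentiableOn ℂ ψ' (Metric.ball 0 1) ∧ ∀ τ : ℂ, 0 < τ.im →
      etaDeriv u τ =
        cexp (2 * Real.pi * I * (e - 1 / 6) * τ) * ψ' (cexp (2 * Real.pi * I * τ)) := by
  refine ⟨fun q => (e * ψ q + q * deriv ψ q) / etaProd q ^ 4, ?_, ?_⟩
  · refine DifferentiableOn.div ((hψ.const_mul e).add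
      (differentiableOn_id.mul (hψ.deriv Metric.isOpen_ball))) (differentiableOn_etaProd.pow 4) ?_
    exact fun q hq => pow_ne_zero _ (etaProd_ne_zero (by simpa using hq))
  · intro τ hτ
    have hev : u =ᶠ[nhds τ] fun τ =>
        cexp (2 * Real.pi * I * e * τ) * ψ (cexp (2 * Real.pi * I * τ)) := by
      filter_upwards [isOpen_upper.mem_nhds hτ] with s hs using h s hs
    have hq := norm_exp_two_pi_I_mul_lt_one hτ
    have hexp : ∀ x : ℂ, HasDerivAt (fun τ => cexp (x * τ)) (cexp (x * τ) * x) τ := fun x => by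
      simpa using ((hasDerivAt_id τ).const_mul x).cexp
    have hd := (hexp (2 * Real.pi * I * e)).mul
      (((hψ.differentiableAt (Metric.isOpen_ball.mem_nhds (by simpa using hq))).hasDerivAt).comp τ
        (hexp (2 * Real.pi * I)))
    have hd' : deriv u τ = _ := hev.deriv_eq.trans hd.deriv
    rw [etaDeriv, hd', eta_eq, mul_pow, ← Complex.exp_nat_mul]
    have hsplit : cexp (2 * Real.pi * I * (e - 1 / 6) * τ) =
        cexp (2 * Real.pi * I * e * τ) / cexp ((4 : ℕ) * (2 * Real.pi * I * (1 / 24) * τ)) := by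
      rw [← Complex.exp_sub]; congr 1; push_cast; ring
    rw [hsplit]
    simp only [Function.comp]
    generalize cexp ((4 : ℕ) * (2 * Real.pi * I * (1 / 24) * τ)) = X
    generalize cexp (2 * Real.pi * I * τ) = q at *
    have hpi : (Real.pi : ℂ) ≠ 0 := by exact_mod_cast Real.pi_ne_zero
    have := etaProd_ne_zero hq
    field_simp

theorem etaDeriv_iterate_exp_mul {u ψ : ℂ → ℂ} (e : ℂ)
    (hψ : DifferentiableOn ℂ ψ (Metric.ball 0 1))
    (h : ∀ τ : ℂ, 0 < τ.im →
      u τ = cexp (2 * Real.pi * I * e * τ) * ψ (cexp (2 * Real.pi * I * τ))) (n : ℕ) :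
    ∃ ψ' : ℂ → ℂ, DifferentiableOn ℂ ψ' (Metric.ball 0 1) ∧ ∀ τ : ℂ, 0 < τ.im →
      (etaDeriv^[n] u) τ =
        cexp (2 * Real.pi * I * (e - n / 6) * τ) * ψ' (cexp (2 * Real.pi * I * τ)) := by
  induction n with
  | zero => exact ⟨ψ, hψ, by simpa using h⟩
  | succ n ih =>
    obtain ⟨χ, hχ, hu⟩ := ih
    obtain ⟨χ', hχ', hu'⟩ := etaDeriv_exp_mul _ hχ hu
    refine ⟨χ', hχ', fun τ hτ => ?_⟩
    rw [Function.iterate_succ_apply', hu' τ hτ]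
    congr 2; push_cast; ring

/-- The powers of `δ_q` preserve expansions `q ^ γ × (holomorphic in q)`. -/
theorem MemF.deltaQ_iterate_expansion {k : ℚ} {c : ℤ} (hk : 2 * k = c) {F Fbar : ℂ × ℂ → ℂ}
    {γ : ℚ} (hF : MemF k domH F) (hFbar : MemF k domU Fbar)
    (hFq : ∀ p ∈ domH, F p = qpow γ p.2 * Fbar (phi p)) (n : ℕ) :
    ∃ G : ℂ → ℂ, DifferentiableOn ℂ G (Metric.ball 0 1) ∧ ∀ ω τ : ℂ, ω ≠ 0 → 0 < τ.im →
      (deltaQ^[n] F) (ω, τ) =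
        ω ^ (-(c + 4 * n)) * (qpow γ τ * G (cexp (2 * Real.pi * I * τ))) := by
  have hzpow : ∀ d : ℤ, DifferentiableOn ℂ (fun q => etaProd q ^ d) (Metric.ball 0 1) :=
    fun d q hq => (differentiableOn_etaProd q hq).zpow
      (Or.inl (etaProd_ne_zero (by simpa using hq)))
  have hη : ∀ (τ : ℂ) (d : ℤ), eta τ ^ d = cexp (2 * Real.pi * I * (d / 24) * τ) *
      etaProd (cexp (2 * Real.pi * I * τ)) ^ d := fun τ d => by
    rw [eta_eq, mul_zpow, ← Complex.exp_int_mul]; congr 2; ring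
  obtain ⟨ψ, hψ, hL⟩ := etaDeriv_iterate_exp_mul (u := weightZero c F)
    (ψ := fun q => Fbar (1, q) / etaProd q ^ c) (γ - c / 24) (by
      refine DifferentiableOn.div ?_ (hzpow c)
        fun q hq => zpow_ne_zero _ (etaProd_ne_zero (by simpa using hq))
      exact hFbar.1.comp (f := fun q : ℂ => ((1 : ℂ), q)) (by fun_prop)
        fun q hq => ⟨one_ne_zero, by simpa using hq⟩) (fun τ hτ => by
      rw [weightZero, hFq (1, τ) ⟨one_ne_zero, hτ⟩, hη τ c, qpow, phi]
      have hs : cexp (2 * Real.pi * I * (γ - c / 24) * τ) =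
          cexp (2 * Real.pi * I * γ * τ) / cexp (2 * Real.pi * I * (c / 24) * τ) := by
        rw [← Complex.exp_sub]; congr 1; ring
      rw [hs]
      simp only [div_mul_div_comm]) n
  -- The factor `η^{c+4n}` restores the exponent: `γ - c/24 - n/6 + (c + 4n)/24 = γ`.
  refine ⟨fun q => etaProd q ^ (c + 4 * n) * ψ q, (hzpow _).mul hψ, fun ω τ hω hτ => ?_⟩
  rw [hF.deltaQ_iterate hk n ⟨hω, hτ⟩]
  simp only [div_zpow]
  rw [hη, hL τ hτ, zpow_neg, qpow]
  have hs : cexp (2 * Real.pi * I * γ * τ) =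
      cexp (2 * Real.pi * I * (((c + 4 * n : ℤ) : ℂ) / 24) * τ) *
        cexp (2 * Real.pi * I * (γ - c / 24 - n / 6) * τ) := by
    rw [← Complex.exp_add]; congr 1; push_cast; ring
  rw [hs]
  ring

/-! ### The inversion -/

/-- The factor `τ⁻²` from the chain rule cancels against the `τ²` in the transformation of `η⁴`;
only the eta constant remains. -/
theorem etaDeriv_neg_inv {u v : ℂ → ℂ} (hu : DifferentiableOn ℂ u {τ | 0 < τ.im})
    (h : ∀ τ : ℂ, 0 < τ.im → u (-τ)⁻¹ = v τ) {τ : ℂ} (hτ : 0 < τ.im) :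
    etaDeriv u (-τ)⁻¹ = sqrt I ^ 4 * etaDeriv v τ := by
  have hτ0 := ne_zero_of_im_pos hτ
  have hev : v =ᶠ[nhds τ] fun s => u (-s)⁻¹ := by
    filter_upwards [isOpen_upper.mem_nhds hτ] with s hs using (h s hs).symm
  have h0 : HasDerivAt (fun s : ℂ => (-s)⁻¹) (1 / τ ^ 2) τ := by
    refine ((hasDerivAt_neg τ).fun_inv (neg_ne_zero.2 hτ0)).congr_deriv ?_
    simp
  have hd : deriv v τ = _ := hev.deriv_eq.trans
    (HasDerivAt.comp τ (hu.differentiableAt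
      (isOpen_upper.mem_nhds (im_neg_inv_pos hτ))).hasDerivAt h0).deriv
  have hs : sqrt τ ^ 4 = τ ^ 2 := by rw [← sqrt_sq τ, ← pow_mul]; simp [sqrt_sq]
  rw [etaDeriv, etaDeriv, hd, eta_neg_inv hτ, mul_pow, mul_pow, hs]
  have := eta_ne_zero hτ
  have := sqrt_ne_zero I_ne_zero
  generalize deriv u (-τ)⁻¹ = x
  field_simp

theorem etaDeriv_sum_mul {ι : Type*} (s : Finset ι) (u : ι → ℂ → ℂ)
    (hu : ∀ i, DifferentiableOn ℂ (u i) {τ | 0 < τ.im}) (a : ι → ℂ) {τ : ℂ} (hτ : 0 < τ.im) :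
    etaDeriv (fun τ => ∑ i ∈ s, u i τ * a i) τ = ∑ i ∈ s, etaDeriv (u i) τ * a i := by
  have : deriv (fun τ => ∑ i ∈ s, u i τ * a i) τ = ∑ i ∈ s, deriv (u i) τ * a i :=
    (HasDerivAt.fun_sum fun i _ =>
      ((hu i).differentiableAt (isOpen_upper.mem_nhds hτ)).hasDerivAt.mul_const (a i)).deriv
  simp only [etaDeriv, this, Finset.mul_sum, Finset.sum_div]
  exact Finset.sum_congr rfl fun i _ => by ring

/-- The constant is left as a power of `sqrt I`, so that it cancels exactly against the one produced
by `(η/ω)^{d+4b}`. -/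
theorem etaDeriv_iterate_neg_inv {n : ℕ} {u : Fin n → ℂ → ℂ}
    (hu : ∀ i, DifferentiableOn ℂ (u i) {τ | 0 < τ.im}) (a : Matrix (Fin n) (Fin n) ℂ) (d : ℤ)
    (h : ∀ j, ∀ τ : ℂ, 0 < τ.im → u j (-τ)⁻¹ = sqrt I ^ d * ∑ i, u i τ * a i j) (b : ℕ) :
    ∀ j, ∀ τ : ℂ, 0 < τ.im → (etaDeriv^[b] (u j)) (-τ)⁻¹ =
      sqrt I ^ (d + 4 * b) * ∑ i, (etaDeriv^[b] (u i)) τ * a i j := by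
  induction b with
  | zero => simpa using h
  | succ b ih =>
    intro j τ hτ
    simp only [Function.iterate_succ_apply']
    rw [etaDeriv_neg_inv (v := fun τ => ∑ i, (etaDeriv^[b] (u i)) τ *
      (sqrt I ^ (d + 4 * b) * a i j)) (differentiableOn_etaDeriv_iterate (hu j) b) ?_ hτ,
      etaDeriv_sum_mul _ _ (fun i => differentiableOn_etaDeriv_iterate (hu i) b) _ hτ,
      show d + 4 * ((b + 1 : ℕ) : ℤ) = d + 4 * b + ((4 : ℕ) : ℤ) by push_cast; ring,
      zpow_add₀ (sqrt_ne_zero I_ne_zero) (d + 4 * b), zpow_natCast, Finset.mul_sum, Finset.mul_sum]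
    · exact Finset.sum_congr rfl fun i _ => by ring
    · intro s hs
      rw [ih j s hs, Finset.mul_sum]
      exact Finset.sum_congr rfl fun i _ => by ring

/-- `δ_q` commutes with the inversion `(ω, τ) ↦ (√τ ω, -1/τ)`. -/
theorem deltaQ_iterate_neg_inv {k : ℚ} {c : ℤ} (hk : 2 * k = c) {n : ℕ} {F : Fin n → ℂ × ℂ → ℂ}
    (hF : ∀ j, MemF k domH (F j)) (a : Matrix (Fin n) (Fin n) ℂ)
    (h : ∀ j, ∀ ω τ : ℂ, ω ≠ 0 → 0 < τ.im →
      F j (sqrt τ * ω, (-τ)⁻¹) = ∑ i, F i (ω, τ) * a i j) (b : ℕ)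
    (j : Fin n) {ω τ : ℂ} (hω : ω ≠ 0) (hτ : 0 < τ.im) :
    (deltaQ^[b] (F j)) (sqrt τ * ω, (-τ)⁻¹) = ∑ i, (deltaQ^[b] (F i)) (ω, τ) * a i j := by
  have hsI := sqrt_ne_zero I_ne_zero
  have key := etaDeriv_iterate_neg_inv (u := fun j => weightZero c (F j))
    (fun j => differentiableOn_weightZero c (hF j)) a c (fun j s hs => by
      have hs0 := sqrt_ne_zero (ne_zero_of_im_pos hs)
      have h1 := h j 1 s one_ne_zero hs
      rw [mul_one, (hF j).eq_zpow_mul hk hs0 (im_neg_inv_pos hs)] at h1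
      simp only [weightZero, eta_neg_inv hs, div_mul_eq_mul_div]
      rw [← Finset.sum_div, ← h1, mul_zpow, mul_zpow, inv_zpow, zpow_neg]
      have := zpow_ne_zero c (eta_ne_zero hs)
      have := zpow_ne_zero c hs0
      have := zpow_ne_zero c hsI
      field_simp) b j τ hτ
  have hs0 := sqrt_ne_zero (ne_zero_of_im_pos hτ)
  rw [(hF j).deltaQ_iterate hk b ⟨mul_ne_zero hs0 hω, im_neg_inv_pos hτ⟩]
  simp only [key, eta_neg_inv hτ]
  have hq : (sqrt I)⁻¹ * (sqrt τ * eta τ) / (sqrt τ * ω) = (sqrt I)⁻¹ * (eta τ / ω) := by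
    field_simp
  rw [hq, mul_zpow, inv_zpow, Finset.mul_sum, Finset.mul_sum]
  refine Finset.sum_congr rfl fun i _ => ?_
  rw [(hF i).deltaQ_iterate hk b ⟨hω, hτ⟩]
  have := zpow_ne_zero (c + 4 * b) hsI
  field_simp

/-! ### The metaplectic group -/

theorem coe_SL2_smul (A : SL(2, ℤ)) (τ : ℍ) :
    ((A • τ : ℍ) : ℂ) =
      ((A 0 0 : ℂ) * τ + (A 0 1 : ℂ)) / ((A 1 0 : ℂ) * τ + (A 1 1 : ℂ)) := by
  rw [UpperHalfPlane.coe_specialLinearGroup_apply]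
  simp

theorem SL2_denom_ne_zero (A : SL(2, ℤ)) (τ : ℍ) : (A 1 0 : ℂ) * τ + (A 1 1 : ℂ) ≠ 0 := by
  have := UpperHalfPlane.denom_ne_zero
    (Matrix.SpecialLinearGroup.toGL ((Matrix.SpecialLinearGroup.map (Int.castRingHom ℝ)) A)) τ
  rwa [ModularGroup.denom_apply] at this

theorem SL2_det_cast (A : SL(2, ℤ)) :
    (A 0 0 : ℂ) * (A 1 1 : ℂ) - (A 0 1 : ℂ) * (A 1 0 : ℂ) = 1 := by
  have := A.det_coe
  rw [Matrix.det_fin_two] at this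
  exact_mod_cast this

theorem SL2_denom_mul (A B : SL(2, ℤ)) (τ : ℍ) :
    ((A * B) 1 0 : ℂ) * τ + ((A * B) 1 1 : ℂ) =
      ((A 1 0 : ℂ) * ((B • τ : ℍ) : ℂ) + (A 1 1 : ℂ)) * ((B 1 0 : ℂ) * τ + (B 1 1 : ℂ)) := by
  rw [coe_SL2_smul]
  have := SL2_denom_ne_zero B τ
  simp only [Matrix.SpecialLinearGroup.coe_mul, Matrix.mul_apply, Fin.sum_univ_two]
  push_cast
  field_simp
  ring

theorem Mp2Z.j_ne_zero (g : Mp2Z) (τ : ℍ) : g.j τ ≠ 0 := fun h => by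
  have := g.sq τ
  rw [h, zero_pow two_ne_zero] at this
  exact SL2_denom_ne_zero g.A τ this.symm

@[ext]
theorem Mp2Z.ext {g h : Mp2Z} (hA : g.A = h.A) (hj : ∀ τ, g.j τ = h.j τ) : g = h := by
  cases g; cases h
  obtain rfl : _ = _ := hA
  obtain rfl : _ = _ := funext hj
  rfl

theorem differentiableOn_SL2_smul (A : SL(2, ℤ)) :
    DifferentiableOn ℂ (fun τ : ℂ => ((A • ofComplex τ : ℍ) : ℂ)) {τ : ℂ | 0 < τ.im} := by
  have h : DifferentiableOn ℂ (fun τ : ℂ => ((A 0 0 : ℂ) * τ + (A 0 1 : ℂ)) /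
      ((A 1 0 : ℂ) * τ + (A 1 1 : ℂ))) {τ : ℂ | 0 < τ.im} :=
    DifferentiableOn.div (by fun_prop) (by fun_prop) fun τ hτ => SL2_denom_ne_zero A ⟨τ, hτ⟩
  refine h.congr fun τ hτ => ?_
  rw [coe_SL2_smul, ofComplex_apply_of_im_pos hτ]

instance : Mul Mp2Z where
  mul g h :=
    { A := g.A * h.A
      j := fun τ => g.j (h.A • τ) * h.j τ
      holo := by
        refine DifferentiableOn.mul ?_ h.holo
        refine (g.holo.comp (differentiableOn_SL2_smul h.A)
          fun τ _ => (h.A • ofComplex τ).im_pos).congr fun τ _ => ?_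
        simp
      sq := fun τ => by rw [mul_pow, g.sq, h.sq, SL2_denom_mul] }

instance : One Mp2Z where
  one :=
    { A := 1
      j := fun _ => 1
      holo := differentiableOn_const 1
      sq := fun τ => by simp }

@[simp] theorem Mp2Z.mul_A (g h : Mp2Z) : (g * h).A = g.A * h.A := rfl

@[simp] theorem Mp2Z.mul_j (g h : Mp2Z) (τ : ℍ) : (g * h).j τ = g.j (h.A • τ) * h.j τ := rfl

@[simp] theorem Mp2Z.one_A : (1 : Mp2Z).A = 1 := rfl

@[simp] theorem Mp2Z.one_j (τ : ℍ) : (1 : Mp2Z).j τ = 1 := rfl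

/-- Products and powers suffice: below, the inverses of the generators of `SL(2, ℤ)` are lifted by
`mpS ^ 3` and `mpT (-1)`. -/
instance : Monoid Mp2Z where
  mul_assoc f g h := by
    refine Mp2Z.ext (by simp [mul_assoc]) fun τ => ?_
    simp [mul_assoc, mul_smul]
  one_mul g := by
    refine Mp2Z.ext (by simp) fun τ => ?_
    simp
  mul_one g := by
    refine Mp2Z.ext (by simp) fun τ => ?_
    simp

@[simp] theorem Mp2Z.pow_A (g : Mp2Z) (n : ℕ) : (g ^ n).A = g.A ^ n := by
  induction n with
  | zero => simp
  | succ n ih => simp [pow_succ, ih]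

/-- The lift of `T ^ n`. -/
def mpT (n : ℤ) : Mp2Z where
  A := ModularGroup.T ^ n
  j := fun _ => 1
  holo := differentiableOn_const 1
  sq := fun τ => by simp [ModularGroup.coe_T_zpow]

/-- The lift `(S, √τ)` of `S`. -/
def mpS : Mp2Z where
  A := ModularGroup.S
  j := fun τ => sqrt τ
  holo := by
    have h : DifferentiableOn ℂ sqrt {τ : ℂ | 0 < τ.im} := fun τ hτ =>
      (differentiableAt_sqrt (mem_slitPlane ⟨τ, hτ⟩)).differentiableWithinAt
    refine h.congr fun τ hτ => ?_
    simp [ofComplex_apply_of_im_pos hτ]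
  sq := fun τ => by simp [ModularGroup.coe_S, sqrt_sq]

theorem coe_mpS_smul (τ : ℍ) : ((mpS.A • τ : ℍ) : ℂ) = (-(τ : ℂ))⁻¹ := by
  rw [show mpS.A = ModularGroup.S from rfl, UpperHalfPlane.modular_S_smul]

theorem coe_mpT_smul (n : ℤ) (τ : ℍ) : (((mpT n).A • τ : ℍ) : ℂ) = τ + n := by
  rw [show (mpT n).A = ModularGroup.T ^ n from rfl, UpperHalfPlane.modular_T_zpow_smul]
  simp [add_comm]

/-! ### Identifying elements of the metaplectic group through `η` -/

/-- `η(Aτ) = e j(τ) η(τ)`. -/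
def Mp2Z.HasEtaMultiplier (g : Mp2Z) (e : ℂ) : Prop :=
  ∀ τ : ℍ, eta ((g.A • τ : ℍ) : ℂ) = e * (g.j τ * eta τ)

theorem Mp2Z.HasEtaMultiplier.mul {g h : Mp2Z} {d e : ℂ} (hg : g.HasEtaMultiplier d)
    (hh : h.HasEtaMultiplier e) : (g * h).HasEtaMultiplier (d * e) := fun τ => by
  rw [Mp2Z.mul_A, mul_smul, hg, hh, Mp2Z.mul_j]; ring

theorem Mp2Z.hasEtaMultiplier_one : (1 : Mp2Z).HasEtaMultiplier 1 := fun τ => by simp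

theorem Mp2Z.HasEtaMultiplier.pow {g : Mp2Z} {e : ℂ} (hg : g.HasEtaMultiplier e) (n : ℕ) :
    (g ^ n).HasEtaMultiplier (e ^ n) := by
  induction n with
  | zero => simpa using Mp2Z.hasEtaMultiplier_one
  | succ n ih => rw [pow_succ, pow_succ]; exact ih.mul hg

/-- As `η` has no zeros, `A` and the multiplier determine `j`. Relations in `Mp2Z` thus become
identities between roots of unity, with no tracking of branches of the square root. -/
theorem Mp2Z.HasEtaMultiplier.eq {g h : Mp2Z} {e : ℂ} (hg : g.HasEtaMultiplier e)
    (hh : h.HasEtaMultiplier e) (he : e ≠ 0) (hA : g.A = h.A) : g = h := by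
  refine Mp2Z.ext hA fun τ => ?_
  have h1 := (hg τ).symm.trans ((congrArg (fun A : SL(2, ℤ) => eta ((A • τ : ℍ) : ℂ)) hA).trans
    (hh τ))
  exact mul_right_cancel₀ (eta_ne_zero τ.im_pos) (mul_left_cancel₀ he h1)

theorem hasEtaMultiplier_mpS : mpS.HasEtaMultiplier (sqrt I)⁻¹ := fun τ => by
  rw [coe_mpS_smul, eta_neg_inv τ.im_pos]; rfl

theorem hasEtaMultiplier_mpT : (mpT 1).HasEtaMultiplier (cexp (2 * Real.pi * I * (1 / 24))) :=
  fun τ => by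
    rw [coe_mpT_smul, Int.cast_one, eta_add_one]
    simp [mpT]

theorem sqrt_I_eq_exp : sqrt I = cexp (2 * Real.pi * I * (1 / 24)) ^ 3 := by
  rw [sqrt, cpow_def_of_ne_zero I_ne_zero, log_I, ← Complex.exp_nat_mul]
  congr 1; push_cast; ring

theorem sqrt_I_pow_four : sqrt I ^ 4 = -1 := by
  rw [show (4 : ℕ) = 2 * 2 from rfl, pow_mul, sqrt_sq, I_sq]

theorem mpS_sq : mpS ^ 2 = (mpS * mpT 1) ^ 3 := by
  have h := hasEtaMultiplier_mpS
  refine (h.pow 2).eq ?_ (pow_ne_zero _ (inv_ne_zero (sqrt_ne_zero I_ne_zero))) ?_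
  · have h' := (h.mul hasEtaMultiplier_mpT).pow 3
    convert h' using 1
    -- The cube of `e^{2πi/24}` is `sqrt I`, which cancels one of the three factors `(sqrt I)⁻¹`.
    rw [mul_pow, ← sqrt_I_eq_exp]
    have := sqrt_ne_zero I_ne_zero
    field_simp
  · simp only [Mp2Z.pow_A, Mp2Z.mul_A, mpS, mpT, zpow_one]
    ext i j
    fin_cases i <;> fin_cases j <;>
      simp [ModularGroup.coe_S, ModularGroup.coe_T, pow_succ]

theorem SL2_S_pow_four : ModularGroup.S ^ 4 = 1 := by
  ext i j
  fin_cases i <;> fin_cases j <;> simp [ModularGroup.coe_S, pow_succ]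

/-- The fourth power acts trivially on `τ` but has eta multiplier `-1`, so its `j` must compensate:
it is the nontrivial lift of the identity. -/
theorem mpS_pow_four_j (τ : ℍ) : (mpS ^ 4).j τ = -1 := by
  have h := (hasEtaMultiplier_mpS.pow 4) τ
  rw [inv_pow, sqrt_I_pow_four, Mp2Z.pow_A, show mpS.A = ModularGroup.S from rfl, SL2_S_pow_four,
    one_smul] at h
  refine mul_right_cancel₀ (eta_ne_zero τ.im_pos) ?_
  linear_combination h

theorem mpS_pow_eight : mpS ^ 8 = 1 := by
  have hA : (mpS ^ 4).A = 1 := by rw [Mp2Z.pow_A]; exact SL2_S_pow_four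
  rw [show (8 : ℕ) = 4 + 4 from rfl, pow_add]
  refine Mp2Z.ext (by rw [Mp2Z.mul_A, hA, mul_one, Mp2Z.one_A]) fun τ => ?_
  simp only [Mp2Z.mul_j, mpS_pow_four_j, Mp2Z.one_j]
  norm_num

/-- Two lifts of the same element of `SL(2, ℤ)` agree up to sign. -/
theorem Mp2Z.eq_or_eq_mul_mpS_pow_four {g h : Mp2Z} (hA : g.A = h.A) :
    g = h ∨ g = h * mpS ^ 4 := by
  have hA4 : (mpS ^ 4).A = 1 := by rw [Mp2Z.pow_A]; exact SL2_S_pow_four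
  -- Two continuous square roots of a nonvanishing function on a connected set differ by a constant
  -- sign.
  have key := IsPreconnected.eq_or_eq_neg_of_sq_eq (S := {τ : ℂ | 0 < τ.im})
    (convex_halfSpace_im_gt 0).isPreconnected g.holo.continuousOn h.holo.continuousOn
    (fun τ _ => by simp [g.sq, h.sq, hA]) (fun {τ} _ => h.j_ne_zero _)
  refine key.imp (fun H => ?_) fun H => ?_
  · refine Mp2Z.ext hA fun τ => ?_
    simpa using H τ.im_pos
  · refine Mp2Z.ext (by rw [Mp2Z.mul_A, hA4, mul_one, hA]) fun τ => ?_
    rw [Mp2Z.mul_j, mpS_pow_four_j, hA4, one_smul]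
    simpa using H τ.im_pos

/-! ### Functions transforming by a scalar -/

namespace EllipticRootData

variable {l : ℕ} {V : Type*} [AddCommGroup V] [Module ℝ V] (S : EllipticRootData l V)

theorem dualSq_smul (a : ℂ) (z : Fin l → ℂ) : S.dualSq (a • z) = a ^ 2 * S.dualSq z := by
  simp only [dualSq, Matrix.mulVec_smul, smul_dotProduct, dotProduct_smul, smul_eq_mul]
  ring

theorem mpAct_mul (g h : Mp2Z) (ω : ℂ) (τ : ℍ) (z : Fin l → ℂ) (t : ℂ) :
    S.mpAct (g * h) ω τ z t = S.mpAct g (h.j τ * ω) (h.A • τ)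
      (((h.A 1 0 : ℂ) * τ + (h.A 1 1 : ℂ))⁻¹ • z)
      (t - (h.A 1 0 : ℂ) * S.dualSq z / (2 * ((h.A 1 0 : ℂ) * τ + (h.A 1 1 : ℂ)))) := by
  have hd := SL2_denom_mul g.A h.A τ
  have h1 := SL2_denom_ne_zero h.A τ
  have h2 := SL2_denom_ne_zero g.A (h.A • τ)
  refine Prod.ext (mul_assoc _ _ _) (Prod.ext (congrArg UpperHalfPlane.coe (mul_smul g.A h.A τ))
    (Prod.ext ?_ ?_))
  · change (((g.A * h.A) 1 0 : ℂ) * τ + ((g.A * h.A) 1 1 : ℂ))⁻¹ • z = _ • _ • z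
    rw [hd, mul_inv, smul_smul]
  change t - ((g.A * h.A) 1 0 : ℂ) * S.dualSq z /
    (2 * (((g.A * h.A) 1 0 : ℂ) * τ + ((g.A * h.A) 1 1 : ℂ))) =
    t - _ - (g.A 1 0 : ℂ) * S.dualSq (_ • z) /
      (2 * ((g.A 1 0 : ℂ) * ((h.A • τ : ℍ) : ℂ) + (g.A 1 1 : ℂ)))
  rw [hd, dualSq_smul]
  -- This form of the lower left entry, which uses `det h.A = 1`, splits the shift of `t` into the
  -- contributions of `h` and of `g`.
  have hc : ((g.A * h.A) 1 0 : ℂ) =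
      (h.A 1 0 : ℂ) * ((g.A 1 0 : ℂ) * ((h.A • τ : ℍ) : ℂ) + (g.A 1 1 : ℂ)) +
        (g.A 1 0 : ℂ) / ((h.A 1 0 : ℂ) * τ + (h.A 1 1 : ℂ)) := by
    rw [coe_SL2_smul]
    simp only [Matrix.SpecialLinearGroup.coe_mul, Matrix.mul_apply, Fin.sum_univ_two]
    push_cast
    field_simp
    linear_combination (g.A 1 0 : ℂ) * SL2_det_cast h.A
  have key : ∀ c c' q x y : ℂ, x ≠ 0 → y ≠ 0 → t - (c * y + c' / x) * q / (2 * (y * x)) =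
      t - c * q / (2 * x) - c' * (x⁻¹ ^ 2 * q) / (2 * y) := by
    intro c c' q x y hx hy
    field_simp
    ring
  rw [hc]
  exact key _ _ _ _ _ h1 h2

/-- `Ψ(g p) = s Ψ(p)` on `ℂ^* × Y_ℍ`. -/
def IsSemiInvariant (Ψ : Pt l → ℂ) (g : Mp2Z) (s : ℂ) : Prop :=
  ∀ (ω : ℂ) (τ : ℍ) (z : Fin l → ℂ) (t : ℂ), ω ≠ 0 →
    Ψ (S.mpAct g ω τ z t) = s * Ψ (ω, τ, z, t)

variable {S} {Ψ : Pt l → ℂ}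

theorem IsSemiInvariant.mul {g h : Mp2Z} {s s' : ℂ} (hg : S.IsSemiInvariant Ψ g s)
    (hh : S.IsSemiInvariant Ψ h s') : S.IsSemiInvariant Ψ (g * h) (s * s') :=
  fun ω τ z t hω => by
    rw [mpAct_mul, hg _ _ _ _ (mul_ne_zero (h.j_ne_zero τ) hω), mul_assoc, ← hh ω τ z t hω]
    rfl

theorem isSemiInvariant_one : S.IsSemiInvariant Ψ 1 1 := fun ω τ z t _ => by
  simp [mpAct]

theorem IsSemiInvariant.pow {g : Mp2Z} {s : ℂ} (hg : S.IsSemiInvariant Ψ g s) (n : ℕ) :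
    S.IsSemiInvariant Ψ (g ^ n) (s ^ n) := by
  induction n with
  | zero => simpa using isSemiInvariant_one
  | succ n ih => rw [pow_succ, pow_succ]; exact ih.mul hg

/-- A function invariant under the lift of `T`, and semi-invariant under the lift of `S`, is
invariant under `Mp₂(ℤ)`. -/
theorem isMpInvariant_of_generators {s : ℂ} (hT : ∀ n, S.IsSemiInvariant Ψ (mpT n) 1)
    (hS : S.IsSemiInvariant Ψ mpS s) : S.IsMpInvariant Ψ := by
  -- A nonzero value makes the scalar of each group element unique, so relations in the group become
  -- equations for `s`.
  by_cases hΨ : ∀ (ω : ℂ) (τ : ℍ) (z : Fin l → ℂ) (t : ℂ), ω ≠ 0 → Ψ (ω, τ, z, t) = 0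
  · intro g ω τ z t hω
    rw [hΨ ω τ z t hω]
    exact hΨ _ _ _ _ (mul_ne_zero (g.j_ne_zero τ) hω)
  push Not at hΨ
  obtain ⟨ω₀, τ₀, z₀, t₀, hω₀, h₀⟩ := hΨ
  have huniq : ∀ {g : Mp2Z} {a b : ℂ}, S.IsSemiInvariant Ψ g a → S.IsSemiInvariant Ψ g b →
      a = b := fun ha hb =>
    mul_right_cancel₀ h₀ ((ha ω₀ τ₀ z₀ t₀ hω₀).symm.trans (hb ω₀ τ₀ z₀ t₀ hω₀))
  have h8 : s ^ 8 = 1 := huniq (hS.pow 8) (mpS_pow_eight ▸ isSemiInvariant_one)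
  have h23 : s ^ 2 = (s * 1) ^ 3 := huniq (hS.pow 2) (mpS_sq ▸ (hS.mul (hT 1)).pow 3)
  have hs0 : s ≠ 0 := by rintro rfl; simp at h8
  -- Since `T` acts by `1`, the second relation reads `s² = s³`.
  obtain rfl : s = 1 := mul_left_cancel₀ (pow_ne_zero 2 hs0) (by linear_combination -h23)
  have hpow : ∀ n, S.IsSemiInvariant Ψ (mpS ^ n) 1 := fun n => by simpa using hS.pow n
  have hex : ∀ A : SL(2, ℤ), ∃ g : Mp2Z, g.A = A ∧ S.IsSemiInvariant Ψ g 1 := by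
    intro A
    have hA : A ∈ Subgroup.closure {ModularGroup.S, ModularGroup.T} := by
      rw [SpecialLinearGroup.SL2Z_generators]; trivial
    induction hA using Subgroup.closure_induction'' with
    | mem x hx =>
      rcases hx with rfl | rfl
      · exact ⟨mpS, rfl, hS⟩
      · exact ⟨mpT 1, zpow_one _, hT 1⟩
    | inv_mem x hx =>
      rcases hx with rfl | rfl
      · refine ⟨mpS ^ 3, ?_, hpow 3⟩
        rw [Mp2Z.pow_A]
        exact eq_inv_of_mul_eq_one_left (by rw [← SL2_S_pow_four, pow_succ _ 3]; rfl)
      · exact ⟨mpT (-1), zpow_neg_one _, hT (-1)⟩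
    | one => exact ⟨1, rfl, isSemiInvariant_one⟩
    | mul x y _ _ hx hy =>
      obtain ⟨g, rfl, hg⟩ := hx
      obtain ⟨h, rfl, hh⟩ := hy
      exact ⟨g * h, rfl, by simpa using hg.mul hh⟩
  intro g ω τ z t hω
  -- The given `g` may be the other lift of the same matrix; the two differ by `mpS ^ 4`, which also
  -- acts trivially on `Ψ`.
  obtain ⟨h, hA, hh⟩ := hex g.A
  rw [← one_mul (Ψ (ω, (τ : ℂ), z, t))]
  rcases Mp2Z.eq_or_eq_mul_mpS_pow_four hA.symm with rfl | rfl
  · exact hh ω τ z t hω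
  · have := hh.mul (hpow 4)
    rw [mul_one] at this
    exact this ω τ z t hω

end EllipticRootData

/-! ### Functions on `ℂ^* × Y_X` -/

theorem isOpen_domYH (l : ℕ) : IsOpen (domYH l) :=
  (isOpen_ne_fun continuous_fst continuous_const).inter
    (isOpen_lt continuous_const (Complex.continuous_im.comp (continuous_fst.comp continuous_snd)))

theorem isOpen_domYU (l : ℕ) : IsOpen (domYU l) :=
  (isOpen_ne_fun continuous_fst continuous_const).inter
    (isOpen_lt (continuous_norm.comp (continuous_fst.comp continuous_snd)) continuous_const)

/-- Combinations with coefficients `ω ^ M C_j(τ)` preserve the index and shift the weight. -/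
theorem MemFY.zpow_mul_sum {l n : ℕ} {k k' : ℚ} {m M : ℤ} {D : Set (Pt l)} (hD : IsOpen D)
    (hD0 : ∀ p ∈ D, p.1 ≠ 0) {g : Fin n → Pt l → ℂ} (hg : ∀ j, MemFY k m D (g j))
    {C : Fin n → ℂ → ℂ} (hC : ∀ j, DifferentiableOn ℂ (fun p : Pt l => C j p.2.1) D)
    (hk' : -2 * k' = -2 * k + M) :
    MemFY k' m D (fun p => p.1 ^ M * ∑ j, g j p * C j p.2.1) := by
  have hgd : ∀ j, ∀ p ∈ D, DifferentiableAt ℂ (g j) p := fun j p hp =>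
    (hg j).1.differentiableAt (hD.mem_nhds hp)
  refine ⟨?_, fun p hp => ⟨?_, ?_⟩⟩
  · refine DifferentiableOn.mul (fun p hp => ?_)
      (DifferentiableOn.fun_sum fun j _ => (hg j).1.mul (hC j))
    exact (differentiableAt_fst.zpow (Or.inl (hD0 p hp))).differentiableWithinAt
  · have hd : ∀ j, HasDerivAt (fun w => g j (w, p.2)) (deriv (fun w => g j (w, p.2)) p.1) p.1 :=
      fun j => DifferentiableAt.hasDerivAt (DifferentiableAt.comp (f := fun w : ℂ => (w, p.2))
        (g := g j) p.1 (hgd j p hp) (by fun_prop))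
    have hs := HasDerivAt.fun_sum (u := Finset.univ) fun j _ => (hd j).mul_const (C j p.2.1)
    have h := ((hasDerivAt_zpow M p.1 (Or.inl (hD0 p hp))).mul hs).deriv
    have hE : ∀ j, deriv (fun w => g j (w, p.2)) p.1 = (-2 * k : ℚ) * g j p / p.1 := fun j => by
      rw [← ((hg j).2 p hp).1, Eω]
      field_simp [hD0 p hp]
    refine (congrArg (p.1 * ·) h).trans ?_
    simp only [hE]
    rw [hk', zpow_sub_one₀ (hD0 p hp)]
    have : ∀ j, (-2 * k : ℚ) * g j p / p.1 * C j p.2.1 =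
        ((-2 * k : ℚ) / p.1 : ℂ) * (g j p * C j p.2.1) := fun j => by ring
    simp only [this]
    rw [← Finset.mul_sum]
    have := hD0 p hp
    push_cast
    field_simp
    ring
  · have hd : ∀ j, HasDerivAt (fun s => g j (p.1, p.2.1, p.2.2.1, s))
        (deriv (fun s => g j (p.1, p.2.1, p.2.2.1, s)) p.2.2.2) p.2.2.2 :=
      fun j => DifferentiableAt.hasDerivAt (DifferentiableAt.comp
        (f := fun s : ℂ => ((p.1, p.2.1, p.2.2.1, s) : Pt l))
        (g := g j) p.2.2.2 (hgd j p hp) (by fun_prop))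
    have hs := HasDerivAt.fun_sum (u := Finset.univ) fun j _ => (hd j).mul_const (C j p.2.1)
    have h := (hs.const_mul (p.1 ^ M)).deriv
    refine (congrArg ((2 * Real.pi * I)⁻¹ * ·) h).trans ?_
    have hE : ∀ j, (2 * Real.pi * I)⁻¹ * (deriv (fun s => g j (p.1, p.2.1, p.2.2.1, s)) p.2.2.2 *
        C j p.2.1) = m * (g j p * C j p.2.1) := fun j => by
      rw [← mul_assoc, ← mul_assoc, ← ((hg j).2 p hp).2, EΛ]
    simp only
    rw [mul_left_comm, Finset.mul_sum, Finset.sum_congr rfl fun j _ => hE j, ← Finset.mul_sum]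
    ring

theorem qpow_add_int (γ : ℚ) (τ : ℂ) : qpow γ (τ + 1) = cexp (2 * Real.pi * I * γ) * qpow γ τ := by
  rw [qpow, qpow, ← Complex.exp_add]; congr 1; ring

/-! ### The elliptic Weyl group -/

namespace EllipticRootData

variable {l : ℕ} {V : Type*} [AddCommGroup V] [Module ℝ V] (S : EllipticRootData l V)

/-- Vectors of the radical are orthogonal to all roots. Applied to `a` and `δ`, this shows that `W`
preserves `τ`. -/
theorem apply_of_mem_W {g : V ≃ₗ[ℝ] V} (hg : g ∈ S.W) {x : V}
    (hx : x ∈ formRadical S.form S.F) : g x = x := by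
  induction hg using Subgroup.closure_induction with
  | mem g hg =>
    obtain ⟨α, hα, hg⟩ := hg
    have h0 : S.form x α = 0 := by
      rw [S.symm]
      exact hx.2 α (S.isElliptic.subset α hα)
    simp [hg, refl, coroot, h0]
  | one => rfl
  | mul g h _ _ hg hh => rw [LinearEquiv.mul_apply, hh, hg]
  | inv g _ hg => exact (LinearEquiv.symm_apply_eq g).2 hg.symm

theorem a_mem_formRadical : S.a ∈ formRadical S.form S.F :=
  ((S.lattice_rad S.a).2 ⟨1, 0, by simp⟩).2

theorem δ_mem_formRadical : S.δ ∈ formRadical S.form S.F :=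
  ((S.lattice_rad S.δ).2 ⟨0, 1, by simp⟩).2

theorem coord_fst_of_mem_W {g : V ≃ₗ[ℝ] V} (hg : g ∈ S.W) (x : V →ₗ[ℝ] ℂ) :
    (S.coord (x ∘ₗ (g⁻¹ : V ≃ₗ[ℝ] V).toLinearMap)).1 = (S.coord x).1 := by
  have ha := S.apply_of_mem_W (inv_mem hg) S.a_mem_formRadical
  have hδ := S.apply_of_mem_W (inv_mem hg) S.δ_mem_formRadical
  simp only [coord, LinearMap.comp_apply, LinearEquiv.coe_coe, ha, hδ]

variable {S}

theorem IsWInvariant.zpow_mul_sum {n : ℕ} {M : ℤ} {g : Fin n → Pt l → ℂ}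
    (hg : ∀ j, S.IsWInvariant (g j)) (C : Fin n → ℂ → ℂ) :
    S.IsWInvariant (fun p => p.1 ^ M * ∑ j, g j p * C j p.2.1) := by
  intro w hw x hx ω hω
  simp only [S.coord_fst_of_mem_W hw, hg _ w hw x hx ω hω]

/-- A combination of functions in `F^W_{k,m}(ℂ^* × Y_U)` with coefficients `ω ^ M C_j(q)`. -/
theorem MemFWU.zpow_mul_sum {n : ℕ} {k k' : ℚ} {m M : ℤ} {g : Fin n → Pt l → ℂ}
    (hg : ∀ j, S.MemFWU k m (g j)) {C : Fin n → ℂ → ℂ}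
    (hC : ∀ j, DifferentiableOn ℂ (C j) (Metric.ball 0 1)) (hk' : -2 * k' = -2 * k + M) :
    S.MemFWU k' m (fun p => p.1 ^ M * ∑ j, g j p * C j p.2.1) := by
  refine ⟨MemFY.zpow_mul_sum (isOpen_domYU l) (fun p hp => hp.1) (fun j => (hg j).1)
    (fun j => ?_) hk', ?_, ?_⟩
  · exact (hC j).comp (f := fun p : Pt l => p.2.1) (by fun_prop) fun p hp => by simpa using hp.2
  · refine MemFY.zpow_mul_sum (g := fun j => g j ∘ phiY)
      (C := fun j τ => C j (cexp (2 * Real.pi * I * τ))) (isOpen_domYH l) (fun p hp => hp.1)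
      (fun j => (hg j).2.1) (fun j => ?_) hk'
    exact (hC j).comp (f := fun p : Pt l => cexp (2 * Real.pi * I * p.2.1)) (by fun_prop)
      fun p hp => by simpa using norm_exp_two_pi_I_mul_lt_one hp.2
  · exact IsWInvariant.zpow_mul_sum (g := fun j => g j ∘ phiY) (fun j => (hg j).2.2)
      fun j τ => C j (cexp (2 * Real.pi * I * τ))

/-! ### The explicit action of the generators -/

variable (S)

theorem mpAct_mpT (n : ℤ) (ω : ℂ) (τ : ℍ) (z : Fin l → ℂ) (t : ℂ) :
    S.mpAct (mpT n) ω τ z t = (ω, (τ : ℂ) + n, z, t) := by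
  have h10 : (mpT n).A 1 0 = 0 := by simp [mpT, ModularGroup.coe_T_zpow]
  have h11 : (mpT n).A 1 1 = 1 := by simp [mpT, ModularGroup.coe_T_zpow]
  simp only [mpAct, coe_mpT_smul, h10, h11]
  simp [mpT]

/-- Translations of `τ` by integers do not change `q`. -/
theorem isSemiInvariant_mpT_comp_phiY (Φ : Pt l → ℂ) (n : ℤ) :
    S.IsSemiInvariant (Φ ∘ phiY) (mpT n) 1 := fun ω τ z t _ => by
  rw [mpAct_mpT, one_mul]
  simp only [Function.comp, phiY]
  rw [mul_add, Complex.exp_add, mul_comm (2 * (Real.pi : ℂ) * I) n, Complex.exp_int_mul_two_pi_mul_I,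
    mul_one]

end EllipticRootData

theorem act_mpT (n : ℤ) (ω : ℂ) (τ : ℍ) : (mpT n).act ω τ = (ω, (τ : ℂ) + n) := by
  simp only [Mp2Z.act, coe_mpT_smul]
  simp [mpT]

theorem act_mpS (ω : ℂ) (τ : ℍ) : mpS.act ω τ = (sqrt τ * ω, (-(τ : ℂ))⁻¹) := by
  simp only [Mp2Z.act, coe_mpS_smul]
  rfl

theorem Mp2Z.act_mul (g h : Mp2Z) (ω : ℂ) (τ : ℍ) :
    (g * h).act ω τ = g.act (h.j τ * ω) (h.A • τ) :=
  Prod.ext (mul_assoc _ _ _) (congrArg UpperHalfPlane.coe (mul_smul g.A h.A τ))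

/-! ### Vector valued forms -/

section VectorValued

variable {l r : ℕ} {V : Type*} [AddCommGroup V] [Module ℝ V] {S : EllipticRootData l V}
  {k : ℚ} {c : ℤ} {f fbar : Fin (r + 1) → Pt l → ℂ} {F Fbar : Fin (r + 1) → ℂ × ℂ → ℂ}
  {γ : Fin (r + 1) → ℚ} {ρ : Mp2Z → Matrix.GeneralLinearGroup (Fin (r + 1)) ℂ}

/-- Matrices with the same effect on a linearly independent system of pairs agree. -/
theorem matrix_eq_of_vecMul_eq
    (hlin : ∀ c : Fin (r + 1) → ℂ, (∀ p ∈ domYH l, ∑ j, c j * f j p = 0) →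
      (∀ p ∈ domH, ∑ j, c j * F j p = 0) → c = 0)
    {A B : Matrix (Fin (r + 1)) (Fin (r + 1)) ℂ}
    (hf : ∀ (ω : ℂ) (τ : ℍ) (z : Fin l → ℂ) (t : ℂ), ω ≠ 0 →
      Matrix.vecMul (fun j => f j (ω, (τ : ℂ), z, t)) A =
        Matrix.vecMul (fun j => f j (ω, (τ : ℂ), z, t)) B)
    (hF : ∀ (ω : ℂ) (τ : ℍ), ω ≠ 0 →
      Matrix.vecMul (fun j => F j (ω, (τ : ℂ))) A =
        Matrix.vecMul (fun j => F j (ω, (τ : ℂ))) B) : A = B := by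
  have hcol : ∀ (v : Fin (r + 1) → ℂ) (j : Fin (r + 1)), Matrix.vecMul v A = Matrix.vecMul v B →
      ∑ i, (A i j - B i j) * v i = 0 := fun v j h => by
    have := congrFun h j
    simp only [Matrix.vecMul, dotProduct] at this
    rw [← sub_eq_zero, ← Finset.sum_sub_distrib] at this
    rw [← this]
    exact Finset.sum_congr rfl fun i _ => by ring
  ext i j
  have := hlin (fun i => A i j - B i j)
    (fun ⟨ω, τ, z, t⟩ hp => hcol _ j (hf ω ⟨τ, hp.2⟩ z t hp.1))
    (fun ⟨ω, τ⟩ hp => hcol _ j (hF ω ⟨τ, hp.2⟩ hp.1))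
  exact sub_eq_zero.1 (congrFun this i)

/-- The exponents of a linearly independent system of pairs have `24 γ ∈ ℤ`. -/
theorem exists_int_eq_mul_sum
    (hfq : ∀ j, ∀ p ∈ domYH l, f j p = qpow (γ j) p.2.1 * fbar j (phiY p))
    (hFq : ∀ j, ∀ p ∈ domH, F j p = qpow (γ j) p.2 * Fbar j (phi p))
    (hfρ : ∀ (g : Mp2Z) (ω : ℂ) (τ : ℍ) (z : Fin l → ℂ) (t : ℂ), ω ≠ 0 →
      (fun j => f j (S.mpAct g ω τ z t)) =
        Matrix.vecMul (fun j => f j (ω, (τ : ℂ), z, t)) (ρ g).val)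
    (hFρ : ∀ (g : Mp2Z) (ω : ℂ) (τ : ℍ), ω ≠ 0 →
      (fun j => F j (g.act ω τ)) = Matrix.vecMul (fun j => F j (ω, (τ : ℂ))) (ρ g).val)
    (hlin : ∀ c : Fin (r + 1) → ℂ, (∀ p ∈ domYH l, ∑ j, c j * f j p = 0) →
      (∀ p ∈ domH, ∑ j, c j * F j p = 0) → c = 0) :
    ∃ N : ℤ, 24 * ∑ j, γ j = (N : ℚ) := by
  -- The order is reversed because `ρ` acts on row vectors from the right; taking determinants
  -- removes the reversal.
  have hmul : ∀ g h, (ρ (g * h)).val = (ρ h).val * (ρ g).val := fun g h => by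
    refine matrix_eq_of_vecMul_eq hlin (fun ω τ z t hω => ?_) fun ω τ hω => ?_
    · rw [← hfρ _ _ _ _ _ hω, ← Matrix.vecMul_vecMul, ← hfρ _ _ _ _ _ hω]
      simp only [S.mpAct_mul]
      exact hfρ g _ _ _ _ (mul_ne_zero (h.j_ne_zero τ) hω)
    · rw [← hFρ _ _ _ hω, ← Matrix.vecMul_vecMul, ← hFρ _ _ _ hω]
      simp only [Mp2Z.act_mul]
      exact hFρ g _ _ (mul_ne_zero (h.j_ne_zero τ) hω)
  have hone : (ρ 1).val = 1 := by
    refine matrix_eq_of_vecMul_eq hlin (fun ω τ z t hω => ?_) fun ω τ hω => ?_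
    · rw [← hfρ _ _ _ _ _ hω, Matrix.vecMul_one]
      simp [EllipticRootData.mpAct]
    · rw [← hFρ _ _ _ hω, Matrix.vecMul_one]
      simp [Mp2Z.act]
  let d : Mp2Z →* ℂ :=
    { toFun := fun g => (ρ g).val.det
      map_one' := by rw [hone, Matrix.det_one]
      map_mul' := fun g h => by rw [hmul, Matrix.det_mul, mul_comm] }
  have hphi : ∀ τ : ℂ, cexp (2 * Real.pi * I * (τ + 1)) = cexp (2 * Real.pi * I * τ) :=
    exp_two_pi_I_mul_add_one
  have hT : (ρ (mpT 1)).val = Matrix.diagonal fun j => cexp (2 * Real.pi * I * γ j) := by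
    refine matrix_eq_of_vecMul_eq hlin (fun ω τ z t hω => ?_) fun ω τ hω => ?_
    · rw [← hfρ _ _ _ _ _ hω]
      ext j
      rw [Matrix.vecMul_diagonal, S.mpAct_mpT, Int.cast_one, hfq j (ω, (τ : ℂ), z, t) ⟨hω, τ.im_pos⟩,
        hfq j _ ⟨hω, by simpa using τ.im_pos⟩]
      simp only [phiY, hphi, qpow_add_int]
      ring
    · rw [← hFρ _ _ _ hω]
      ext j
      rw [Matrix.vecMul_diagonal, act_mpT, Int.cast_one, hFq j (ω, (τ : ℂ)) ⟨hω, τ.im_pos⟩,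
        hFq j _ ⟨hω, by simpa using τ.im_pos⟩]
      simp only [phi, hphi, qpow_add_int]
      ring
  have hdT : d (mpT 1) = cexp (2 * Real.pi * I * ∑ j, (γ j : ℂ)) := by
    change (ρ (mpT 1)).val.det = _
    rw [hT, Matrix.det_diagonal, ← Complex.exp_sum, Finset.mul_sum]
  have h8 : d mpS ^ 8 = 1 := by rw [← map_pow, mpS_pow_eight, map_one]
  have h23 : d mpS ^ 2 = (d mpS * d (mpT 1)) ^ 3 := by rw [← map_pow, mpS_sq, map_pow, map_mul]
  have hs0 : d mpS ≠ 0 := fun h => by simp [h] at h8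
  -- Cancelling `d(S)²` in `S² = (ST)³`; the eighth power then eliminates `d(S)` and leaves `d(T)^24
  -- = 1`.
  have h1 : d mpS * d (mpT 1) ^ 3 = 1 :=
    mul_left_cancel₀ (pow_ne_zero 2 hs0) (by linear_combination -h23)
  have h24 : d (mpT 1) ^ 24 = 1 := by
    have := congrArg (· ^ 8) h1
    simpa [mul_pow, h8, ← pow_mul] using this
  rw [hdT, ← Complex.exp_nat_mul, Complex.exp_eq_one_iff] at h24
  obtain ⟨N, hN⟩ := h24
  refine ⟨N, ?_⟩
  have : (24 * ∑ j, (γ j : ℂ)) = N := by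
    refine mul_right_cancel₀ Complex.two_pi_I_ne_zero ?_
    rw [← hN]; push_cast; ring
  exact_mod_cast this

/-- The matrix transforms by `ρ` under the lift of `S`. -/
theorem detMatrix_mpAct_mpS (hk : 2 * k = c) (hF : ∀ j, MemF k domH (F j))
    (hfρ : ∀ (g : Mp2Z) (ω : ℂ) (τ : ℍ) (z : Fin l → ℂ) (t : ℂ), ω ≠ 0 →
      (fun j => f j (S.mpAct g ω τ z t)) =
        Matrix.vecMul (fun j => f j (ω, (τ : ℂ), z, t)) (ρ g).val)
    (hFρ : ∀ (g : Mp2Z) (ω : ℂ) (τ : ℍ), ω ≠ 0 →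
      (fun j => F j (g.act ω τ)) = Matrix.vecMul (fun j => F j (ω, (τ : ℂ))) (ρ g).val)
    (β : Fin r → ℕ) (ω : ℂ) (τ : ℍ) (z : Fin l → ℂ) (t : ℂ) (hω : ω ≠ 0) :
    detMatrix f F β (S.mpAct mpS ω τ z t) =
      detMatrix f F β (ω, (τ : ℂ), z, t) * (ρ mpS).val := by
  ext i j
  rw [Matrix.mul_apply]
  refine Fin.cases ?_ (fun i => ?_) i
  · exact congrFun (hfρ mpS ω τ z t hω) j
  · have hact : (S.mpAct mpS ω τ z t).1 = sqrt τ * ω ∧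
        (S.mpAct mpS ω τ z t).2.1 = (-(τ : ℂ))⁻¹ := ⟨rfl, coe_mpS_smul τ⟩
    simp only [detMatrix, Matrix.of_apply, Fin.cons_succ, hact]
    refine deltaQ_iterate_neg_inv hk hF (ρ mpS).val (fun j ω' τ' hω' hτ' => ?_) (β i) j hω τ.im_pos
    have := congrFun (hFρ mpS ω' ⟨τ', hτ'⟩ hω') j
    rw [act_mpS] at this
    exact this

/-- The `q`-expansion of `(η/ω)^{-24γ} det Δ`. -/
theorem exists_detMatrix_expansion (hk : 2 * k = c) (hF : ∀ j, MemF k domH (F j))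
    (hFbar : ∀ j, MemF k domU (Fbar j))
    (hfq : ∀ j, ∀ p ∈ domYH l, f j p = qpow (γ j) p.2.1 * fbar j (phiY p))
    (hFq : ∀ j, ∀ p ∈ domH, F j p = qpow (γ j) p.2 * Fbar j (phi p))
    (β : Fin r → ℕ) {N : ℤ} (hN : 24 * ∑ j, γ j = (N : ℚ)) :
    ∃ C : Fin (r + 1) → ℂ → ℂ, (∀ j, DifferentiableOn ℂ (C j) (Metric.ball 0 1)) ∧
      ∀ p ∈ domYH l, (eta p.2.1 / p.1) ^ (-N) * (detMatrix f F β p).det =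
        p.1 ^ (N - ∑ i, (c + 4 * (β i : ℤ))) *
          ∑ j, fbar j (phiY p) * C j (cexp (2 * Real.pi * I * p.2.1)) := by
  choose G hGd hG using fun i j => (hF j).deltaQ_iterate_expansion hk (hFbar j) (hFq j) (β i)
  -- The coefficients are the cofactors of the first row, stripped of their powers of `ω` and
  -- `q^{γ_j}`, times the integral part of `η^{-N}`.
  refine ⟨fun j q => etaProd q ^ (-N) * ((-1) ^ (j : ℕ) *
    (Matrix.of fun i j' => G i (j.succAbove j') q).det), fun j => ?_, ?_⟩
  · refine DifferentiableOn.mul (fun q hq => ?_) (DifferentiableOn.const_mul ?_ _)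
    · exact (differentiableOn_etaProd q hq).zpow (Or.inl (etaProd_ne_zero (by simpa using hq)))
    · simp only [Matrix.det_apply]
      refine DifferentiableOn.fun_sum fun σ _ => DifferentiableOn.const_smul ?_ _
      exact DifferentiableOn.fun_finsetProd fun i _ => hGd _ _
  · rintro ⟨ω, τ, z, t⟩ ⟨hω, hτ⟩
    simp only at hω hτ ⊢
    -- This is where `N = 24 ∑ γ_j` enters: the `q^{-N/24}` of the eta power cancels all the
    -- `q^{γ_j}`.
    have hγ : cexp (2 * Real.pi * I * (1 / 24) * τ) ^ (-N) * ∏ j, qpow (γ j) τ = 1 := by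
      have hN' : (24 * ∑ j, (γ j : ℂ)) = N := by exact_mod_cast hN
      simp only [qpow]
      rw [← Complex.exp_int_mul, ← Complex.exp_sum, ← Complex.exp_add, ← Finset.sum_mul,
        ← Finset.mul_sum]
      rw [Complex.exp_eq_one_iff]
      refine ⟨0, ?_⟩
      push_cast
      rw [← hN']
      ring
    -- Powers of `ω` come out of the rows and the `q^{γ_j'}` out of the columns. The deleted
    -- column's `q^{γ_j}` will come from `f_j`.
    have hminor : ∀ j : Fin (r + 1), ((detMatrix f F β (ω, τ, z, t)).submatrix Fin.succ
        j.succAbove).det = ω ^ (-∑ i, (c + 4 * (β i : ℤ))) * ((∏ j', qpow (γ (j.succAbove j')) τ) *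
          (Matrix.of fun i j' => G i (j.succAbove j') (cexp (2 * Real.pi * I * τ))).det) := by
      intro j
      have : (detMatrix f F β (ω, τ, z, t)).submatrix Fin.succ j.succAbove =
          Matrix.of fun i j' => ω ^ (-(c + 4 * (β i : ℤ))) *
            (Matrix.of fun i j' => qpow (γ (j.succAbove j')) τ *
              (Matrix.of fun i j' => G i (j.succAbove j') (cexp (2 * Real.pi * I * τ))) i j') i j' := by
        ext i j'
        exact hG i (j.succAbove j') ω τ hω hτ
      rw [this, Matrix.det_mul_column, Matrix.det_mul_row]
      congr 1
      rw [← Finset.sum_neg_distrib]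
      induction (Finset.univ : Finset (Fin r)) using Finset.induction_on with
      | empty => simp
      | insert a s ha ih => rw [Finset.prod_insert ha, Finset.sum_insert ha, zpow_add₀ hω, ih]
    rw [Matrix.det_succ_row_zero, Finset.mul_sum, Finset.mul_sum]
    refine Finset.sum_congr rfl fun j _ => ?_
    rw [hminor, show detMatrix f F β (ω, τ, z, t) 0 j = f j (ω, τ, z, t) from rfl,
      hfq j _ ⟨hω, hτ⟩, eta_eq, div_zpow, mul_zpow, zpow_neg ω N, sub_eq_add_neg, zpow_add₀ hω]
    rw [Fin.prod_univ_succAbove _ j] at hγ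
    simp only [div_inv_eq_mul]
    generalize cexp (2 * Real.pi * I * (1 / 24) * τ) ^ (-N) = X at hγ ⊢
    linear_combination (ω ^ N * ω ^ (-∑ i, (c + 4 * (β i : ℤ))) * fbar j (phiY (ω, τ, z, t)) *
      etaProd (cexp (2 * Real.pi * I * τ)) ^ (-N) * (-1) ^ (j : ℕ) *
      (Matrix.of fun i j' => G i (j.succAbove j') (cexp (2 * Real.pi * I * τ))).det) * hγ

end VectorValued

end EllipticJacobi

end

/-! ### The theorem -/

theorem proposition6p5 {l : ℕ} {V : Type*} [AddCommGroup V] [Module ℝ V]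
    (S : EllipticJacobi.EllipticRootData l V)
    (k : ℚ) (hk : ∃ c : ℤ, 2 * k = c) (m : ℤ) (r : ℕ)
    (f fbar : Fin (r + 1) → EllipticJacobi.Pt l → ℂ)
    (F Fbar : Fin (r + 1) → ℂ × ℂ → ℂ)
    (γ : Fin (r + 1) → ℚ)
    (ρ : EllipticJacobi.Mp2Z → Matrix.GeneralLinearGroup (Fin (r + 1)) ℂ)
    (hf : ∀ j, S.MemFWH k m (f j))
    (hfbar : ∀ j, S.MemFWU k m (fbar j))
    (hF : ∀ j, EllipticJacobi.MemF k EllipticJacobi.domH (F j))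
    (hFbar : ∀ j, EllipticJacobi.MemF k EllipticJacobi.domU (Fbar j))
    (hfq : ∀ j, ∀ p ∈ EllipticJacobi.domYH l,
      f j p = EllipticJacobi.qpow (γ j) p.2.1 * fbar j (EllipticJacobi.phiY p))
    (hFq : ∀ j, ∀ p ∈ EllipticJacobi.domH,
      F j p = EllipticJacobi.qpow (γ j) p.2 * Fbar j (EllipticJacobi.phi p))
    (hfρ : ∀ (g : EllipticJacobi.Mp2Z) (ω : ℂ) (τ : UpperHalfPlane) (z : Fin l → ℂ) (t : ℂ),
      ω ≠ 0 →
      (fun j => f j (S.mpAct g ω τ z t)) =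
        Matrix.vecMul (fun j => f j (ω, (τ : ℂ), z, t)) (ρ g).val)
    (hFρ : ∀ (g : EllipticJacobi.Mp2Z) (ω : ℂ) (τ : UpperHalfPlane), ω ≠ 0 →
      (fun j => F j (g.act ω τ)) = Matrix.vecMul (fun j => F j (ω, (τ : ℂ))) (ρ g).val)
    (β : Fin r → ℕ) :
    -- `24 γ ∈ ℤ`, if the pairs `(f_j, F_j)` are linearly independent over `ℂ`
    -- (in particular, if the determinant is not identically zero)
    ((∀ c : Fin (r + 1) → ℂ,
        (∀ p ∈ EllipticJacobi.domYH l, ∑ j, c j * f j p = 0) →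
        (∀ p ∈ EllipticJacobi.domH, ∑ j, c j * F j p = 0) → c = 0) →
      ∃ N : ℤ, 24 * ∑ j, γ j = (N : ℚ)) ∧
    -- and `(η/ω)^{-24γ} det Δ` is a Jacobi form
    (∀ N : ℤ, 24 * ∑ j, γ j = (N : ℚ) →
      ∃ Φ : EllipticJacobi.Pt l → ℂ,
        S.IsJacobiForm (k * (r + 1) + 2 * ∑ i, (β i : ℚ) - 12 * ∑ j, γ j) m Φ ∧
        ∀ p ∈ EllipticJacobi.domYH l,
          Φ (EllipticJacobi.phiY p) =
            (ModularForm.eta p.2.1 / p.1) ^ (-N) *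
              (EllipticJacobi.detMatrix f F β p).det) := by
  open EllipticJacobi EllipticRootData in
  obtain ⟨c, hc⟩ := hk
  refine ⟨exists_int_eq_mul_sum hfq hFq hfρ hFρ, fun N hN => ?_⟩
  obtain ⟨C, hC, hexp⟩ := exists_detMatrix_expansion hc hF hFbar hfq hFq β hN
  -- The Jacobi form is defined by its expansion in `q`, which makes sense at `q = 0`, where `det Δ`
  -- itself does not.
  refine ⟨fun p => p.1 ^ (N - ∑ i, (c + 4 * (β i : ℤ))) * ∑ j, fbar j p * C j p.2.1,
    ⟨MemFWU.zpow_mul_sum hfbar hC ?_, ?_⟩, fun p hp => (hexp p hp).symm⟩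
  · push_cast
    rw [← hN, ← hc, Finset.sum_add_distrib, Finset.sum_const, Finset.card_univ, Fintype.card_fin,
      nsmul_eq_mul, ← Finset.mul_sum]
    ring
  · refine isMpInvariant_of_generators
      (s := (Complex.sqrt Complex.I)⁻¹ ^ (-N) * (ρ mpS).val.det)
      (S.isSemiInvariant_mpT_comp_phiY _) fun ω τ z t hω => ?_
    have hS := hexp (S.mpAct mpS ω τ z t)
      ⟨mul_ne_zero (mpS.j_ne_zero τ) hω, (mpS.A • τ).im_pos⟩
    rw [detMatrix_mpAct_mpS hc hF hfρ hFρ β ω τ z t hω, Matrix.det_mul,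
      show (S.mpAct mpS ω τ z t).2.1 = (-(τ : ℂ))⁻¹ from coe_mpS_smul τ,
      show (S.mpAct mpS ω τ z t).1 = Complex.sqrt τ * ω from rfl, eta_neg_inv τ.im_pos] at hS
    refine Eq.trans ?_ (hS.symm.trans ?_)
    · simp only [Function.comp, phiY]
      rw [show (S.mpAct mpS ω τ z t).2.1 = (-(τ : ℂ))⁻¹ from coe_mpS_smul τ]
      rfl
    · refine Eq.trans ?_ (congrArg (_ * ·) (hexp (ω, (τ : ℂ), z, t) ⟨hω, τ.im_pos⟩))
      have hs := sqrt_ne_zero (UpperHalfPlane.ne_zero τ)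
      have hq : (Complex.sqrt Complex.I)⁻¹ * (Complex.sqrt τ * ModularForm.eta τ) /
          (Complex.sqrt τ * ω) = (Complex.sqrt Complex.I)⁻¹ * (ModularForm.eta τ / ω) := by
        field_simp
      rw [hq, mul_zpow]
      ring
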